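/- Let $n,m$ be integers with $2\le m<n$, let $X$ be a random variable with values in $\{x_1,\dots,x_n\}$ and distribution $\mathbf p=(p_1,\dots,p_n)$, where $p_i=P\{X=x_i\}\ge 0$ and $\sum_i p_i=1$. Let $\mathcal F_m$ be the set of surjective functions from $\{x_1,\dots,x_n\}$ onto a set with $m$ elements, let $H$ denote Shannon entropy in bits, and put $$\alpha=1-\frac{1+\ln(\ln 2)}{\ln 2}.$$ A Huffman step on a partition of $\{x_1,\dots,x_n\}$ replaces two blocks of smallest probability (ties broken arbitrarily) by their union. Then $\alpha<0.0861$, and the following hold. (a) For every such $\mathbf p$ (with real entries), exactly $n-m$ Huffman steps can be carried out from the partition into singletons, and every $f\in\mathcal F_m$ whose fibres are the $m$ blocks obtained in this way satisfies $$\max_{g\in\mathcal F_m}H(g(X))-\alpha\;\le\; H(f(X))\;\le\;\max_{g\in\mathcal F_m}H(g(X)).$$ (b) There is an algorithm (a program for a random access machine with logarithmic cost) which, given $m$ and a distribution $\mathbf p$ with rational entries (numerators and denominators written in binary), where $2\le m<n$, halts in time polynomial in the number of bits of the input and outputs a function $f\in\mathcal F_m$ obtained by $n-m$ Huffman steps as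 in (a), so that $\max_{g\in\mathcal F_m}H(g(X))-\alpha\le H(f(X))\le\max_{g\in\mathcal F_m}H(g(X))$, together with a rational number $v$ such that $\bigl|v-\max_{g\in\mathcal F_m}H(g(X))\bigr|\le\alpha$. -/

import Mathlib

/-! ### Entropy of a function of a finite random variable -/

/-- Shannon entropy, in bits, of a finite vector of probabilities (`0 log 0 = 0`). -/
noncomputable def shannonEntropy {k : ℕ} (a : Fin k → ℝ) : ℝ :=
  -∑ i, a i * Real.logb 2 (a i)

/-- The distribution of `f(X)` when `X` takes the value `i` with probability `p i`. -/
noncomputable def distOfFun {n m : ℕ} (p : Fin n → ℝ) (f : Fin n → Fin m) : Fin m → ℝ :=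
  fun j => ∑ i with f i = j, p i

/-- The set of the values `H(f(X))`, where `f` ranges over the surjective functions onto a set
with `m` elements. -/
def entropyValues {n : ℕ} (m : ℕ) (p : Fin n → ℝ) : Set ℝ :=
  {h | ∃ f : Fin n → Fin m, Function.Surjective f ∧ h = shannonEntropy (distOfFun p f)}

/-- The constant `α = 1 - (1 + ln (ln 2)) / ln 2`. -/
noncomputable def alphaConst : ℝ :=
  1 - (1 + Real.log (Real.log 2)) / Real.log 2

/-! ### Huffman merge steps -/

/-- One Huffman step on a family `C` of disjoint blocks of outcomes, the weight of a block being
its total probability: two blocks of smallest weight (ties are broken arbitrarily) are replaced by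
their union. -/
def HuffmanStep {n : ℕ} (p : Fin n → ℝ) (C C' : Finset (Finset (Fin n))) : Prop :=
  ∃ A ∈ C, ∃ B ∈ C, A ≠ B ∧
    (∀ D ∈ C, D ≠ A → D ≠ B → ∑ i ∈ A, p i ≤ ∑ i ∈ D, p i ∧ ∑ i ∈ B, p i ≤ ∑ i ∈ D, p i) ∧
    C' = insert (A ∪ B) ((C.erase A).erase B)

/-- `HuffmanRun p k C`: the family `C` arises from the family of all singletons by exactly `k`
Huffman steps. -/
inductive HuffmanRun {n : ℕ} (p : Fin n → ℝ) : ℕ → Finset (Finset (Fin n)) → Prop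
  | zero : HuffmanRun p 0 (Finset.univ.image fun i => {i})
  | succ {k : ℕ} {C C' : Finset (Finset (Fin n))} :
      HuffmanRun p k C → HuffmanStep p C C' → HuffmanRun p (k + 1) C'

/-- `f` is a surjection onto `m` elements whose fibres are the blocks that result from exactly
`n - m` Huffman steps. -/
def IsHuffmanFun {n m : ℕ} (p : Fin n → ℝ) (f : Fin n → Fin m) : Prop :=
  Function.Surjective f ∧
    HuffmanRun p (n - m) (Finset.univ.image fun j => Finset.univ.filter fun i => f i = j)

/-! ### Random access machines with logarithmic cost

A program uses finitely many registers and finitely many arrays, all holding natural numbers.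
Every executed instruction and every test costs one plus the lengths in binary of all the numbers
it touches (operands, array indices, results); this is the usual logarithmic cost criterion, which
agrees with the running time of Turing machines up to a polynomial. -/

namespace RAM

/-- Contents of the registers and of the arrays. -/
structure State where
  reg : ℕ → ℕ
  arr : ℕ → ℕ → ℕ

/-- Arithmetic operations on natural numbers: sum, truncated difference, product, integer
quotient. -/
inductive Op
  | add
  | sub
  | mul
  | div

def Op.eval : Op → ℕ → ℕ → ℕ
  | .add, a, b => a + b
  | .sub, a, b => a - b
  | .mul, a, b => a * b
  | .div, a, b => a / b

/-- Programs. The letters `x y z` are names of registers and `a` is the name of an array. -/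
inductive Prog
  /-- do nothing -/
  | skip
  /-- `x := c` -/
  | const (x c : ℕ)
  /-- `x := y o z` -/
  | op (o : Op) (x y z : ℕ)
  /-- `x := a[y]` -/
  | load (x a y : ℕ)
  /-- `a[x] := y` -/
  | store (a x y : ℕ)
  /-- first `P`, then `Q` -/
  | seq (P Q : Prog)
  /-- if `x < y` then `P` else `Q` -/
  | ite (x y : ℕ) (P Q : Prog)
  /-- while `x < y` do `P` -/
  | while (x y : ℕ) (P : Prog)

def State.setReg (s : State) (x v : ℕ) : State :=
  { s with reg := Function.update s.reg x v }

def State.setArr (s : State) (a i v : ℕ) : State :=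
  { s with arr := Function.update s.arr a (Function.update (s.arr a) i v) }

/-- `Exec P s t s'`: started in state `s`, the program `P` halts in state `s'`, at total cost `t`.
Here `Nat.size v` is the number of binary digits of `v`. -/
inductive Exec : Prog → State → ℕ → State → Prop
  | skip (s : State) : Exec .skip s 1 s
  | const (s : State) (x c : ℕ) : Exec (.const x c) s (1 + c.size) (s.setReg x c)
  | op (s : State) (o : Op) (x y z : ℕ) :
      Exec (.op o x y z) s
        (1 + (s.reg y).size + (s.reg z).size + (o.eval (s.reg y) (s.reg z)).size)
        (s.setReg x (o.eval (s.reg y) (s.reg z)))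
  | load (s : State) (x a y : ℕ) :
      Exec (.load x a y) s (1 + (s.reg y).size + (s.arr a (s.reg y)).size)
        (s.setReg x (s.arr a (s.reg y)))
  | store (s : State) (a x y : ℕ) :
      Exec (.store a x y) s (1 + (s.reg x).size + (s.reg y).size)
        (s.setArr a (s.reg x) (s.reg y))
  | seq {P Q : Prog} {s s' s'' : State} {t u : ℕ} :
      Exec P s t s' → Exec Q s' u s'' → Exec (.seq P Q) s (t + u) s''
  | ite_true {x y : ℕ} {P Q : Prog} {s s' : State} {t : ℕ} :
      s.reg x < s.reg y → Exec P s t s' →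
        Exec (.ite x y P Q) s (1 + (s.reg x).size + (s.reg y).size + t) s'
  | ite_false {x y : ℕ} {P Q : Prog} {s s' : State} {t : ℕ} :
      ¬ s.reg x < s.reg y → Exec Q s t s' →
        Exec (.ite x y P Q) s (1 + (s.reg x).size + (s.reg y).size + t) s'
  | while_true {x y : ℕ} {P : Prog} {s s' s'' : State} {t u : ℕ} :
      s.reg x < s.reg y → Exec P s t s' → Exec (.while x y P) s' u s'' →
        Exec (.while x y P) s (1 + (s.reg x).size + (s.reg y).size + t + u) s''
  | while_false {x y : ℕ} {P : Prog} {s : State} :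
      ¬ s.reg x < s.reg y →
        Exec (.while x y P) s (1 + (s.reg x).size + (s.reg y).size) s

/-- The initial state for the instance `(p, m)`: register `0` holds `n`, register `1` holds `m`,
arrays `0` and `1` hold the numerators and the denominators of `p`, everything else is `0`. -/
def inputState {n : ℕ} (m : ℕ) (p : Fin n → ℚ) : State where
  reg x := if x = 0 then n else if x = 1 then m else 0
  arr a i :=
    if h : i < n then
      if a = 0 then (p ⟨i, h⟩).num.natAbs else if a = 1 then (p ⟨i, h⟩).den else 0
    else 0

/-- The number of bits of the instance `(p, m)`. -/
def inputSize {n : ℕ} (m : ℕ) (p : Fin n → ℚ) : ℕ :=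
  n.size + m.size + ∑ i, ((p i).num.natAbs.size + (p i).den.size)

/-- The state `s` shows the output `(f, v)`: array `0` holds the values of `f`, and `v` is the
quotient of the numbers in the registers `0` and `1`. -/
def IsOutput {n m : ℕ} (s : State) (f : Fin n → Fin m) (v : ℚ) : Prop :=
  (∀ i : Fin n, s.arr 0 i = f i) ∧ s.reg 1 ≠ 0 ∧ v = (s.reg 0 : ℚ) / (s.reg 1 : ℚ)

end RAM

/-!
Along a Huffman run the weight `w` of the block formed last never decreases. Hence every block
weighs at least `w / 2`, and every block heavier than `w` is still a singleton. By the first fact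
and the convexity of `x log x`, replacing the weights that are at most `w` by their mean raises the
entropy by at most `α`; by the second one and Gibbs' inequality, no function onto `m` elements has
more entropy than this levelled distribution.

For the algorithm, bring the probabilities to a common denominator `D` and run Huffman's procedure
on the integer numerators. The entropy is approximated through `log₂ a ≈ size (a ^ k) / k`, where
`size` counts binary digits; the numbers computed from the probabilities are at most
`2 k D ^ (k + 1)`. The error is at most `2 / k`, and `k = 32` suffices because `α ≥ 1 / 16`.
-/

theorem alphaConst_mul_log_two :
    alphaConst * Real.log 2 = Real.log 2 - 1 - Real.log (Real.log 2) := by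
  have hlog : Real.log 2 ≠ 0 := (Real.log_pos one_lt_two).ne'
  rw [alphaConst, sub_mul, div_mul_cancel₀ _ hlog]
  ring

theorem alphaConst_lt : alphaConst < 0.0861 := by
  have hpos : 0 < Real.log 2 := Real.log_pos one_lt_two
  have hexp : 1.4426951 ≤ Real.exp 0.366532 := by
    refine le_trans ?_ (Real.sum_le_exp_of_nonneg (by norm_num) 8)
    norm_num [Finset.sum_range_succ, Nat.factorial]
  have hloglog : -0.366532 ≤ Real.log (Real.log 2) := by
    rw [Real.le_log_iff_exp_le hpos, Real.exp_neg]
    exact (inv_anti₀ (by norm_num) hexp).trans (by linarith [Real.log_two_gt_d9])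
  refine lt_of_mul_lt_mul_right ?_ hpos.le
  rw [alphaConst_mul_log_two]
  linarith [Real.log_two_lt_d9]

theorem one_div_sixteen_le_alphaConst : 1 / 16 ≤ alphaConst := by
  have hpos : 0 < Real.log 2 := Real.log_pos one_lt_two
  have hexp : Real.exp 0.36 ≤ 1.4426 := by
    refine (Real.exp_bound' (by norm_num) (by norm_num) (n := 6) (by norm_num)).trans ?_
    norm_num [Finset.sum_range_succ, Nat.factorial]
  have hloglog : Real.log (Real.log 2) ≤ -0.36 := by
    rw [Real.log_le_iff_le_exp hpos, Real.exp_neg]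
    exact le_trans (by linarith [Real.log_two_lt_d9]) (inv_anti₀ (Real.exp_pos _) hexp)
  refine le_of_mul_le_mul_right ?_ hpos
  rw [alphaConst_mul_log_two]
  linarith [Real.log_two_gt_d9]

theorem mul_log_le_chord {w x : ℝ} (h₁ : w / 2 ≤ x) (h₂ : x ≤ w) :
    x * Real.log x ≤ x * Real.log w + (x - w) * Real.log 2 := by
  obtain hw | hw : 0 = w ∨ 0 < w := eq_or_lt_of_le (by linarith)
  · obtain rfl : x = 0 := by linarith
    simp [← hw]
  have ha : 0 ≤ 2 * (w - x) / w := div_nonneg (by linarith) hw.le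
  have hb : 0 ≤ (2 * x - w) / w := div_nonneg (by linarith) hw.le
  have hconv := Real.convexOn_mul_log.2 (Set.mem_Ici.2 (half_pos hw).le) (Set.mem_Ici.2 hw.le)
    ha hb (by field_simp; ring)
  have hx : 2 * (w - x) / w * (w / 2) + (2 * x - w) / w * w = x := by field_simp; ring
  simp only [smul_eq_mul, hx, Real.log_div hw.ne' two_ne_zero] at hconv
  refine hconv.trans_eq ?_
  field_simp
  ring

/-- The chord bound leaves an excess that depends on `w`. Its worst case over `w`, found from
`log u ≤ u - 1` with `u = w log 2 / mean`, is `α log 2`. -/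
theorem sum_mul_log_le_mul_log_mean_add {ι : Type*} {s : Finset ι} {q : ι → ℝ} {w : ℝ}
    (h₁ : ∀ j ∈ s, w / 2 ≤ q j) (h₂ : ∀ j ∈ s, q j ≤ w) :
    ∑ j ∈ s, q j * Real.log (q j) ≤
      (∑ j ∈ s, q j) * (Real.log ((∑ j ∈ s, q j) / s.card) + alphaConst * Real.log 2) := by
  have hq : ∀ j ∈ s, 0 ≤ q j := fun j hj => by linarith [h₁ j hj, h₂ j hj]
  obtain hT | hT := (Finset.sum_nonneg hq).eq_or_lt
  · rw [← hT, zero_mul]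
    have hzero := (Finset.sum_eq_zero_iff_of_nonneg hq).1 hT.symm
    exact (Finset.sum_eq_zero fun j hj => by rw [hzero j hj, zero_mul]).le
  obtain ⟨j₀, hj₀, hqj₀⟩ := Finset.exists_lt_of_sum_lt (f := fun _ => (0 : ℝ)) (by simpa using hT)
  have hw : 0 < w := hqj₀.trans_le (h₂ j₀ hj₀)
  have hcard : (0 : ℝ) < s.card := Nat.cast_pos.2 (Finset.card_pos.2 ⟨j₀, hj₀⟩)
  have hlog : 0 < Real.log 2 := Real.log_pos one_lt_two
  set T := ∑ j ∈ s, q j with hTdef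
  have hmean : 0 < T / s.card := div_pos hT hcard
  calc ∑ j ∈ s, q j * Real.log (q j)
      ≤ ∑ j ∈ s, (q j * Real.log w + (q j - w) * Real.log 2) :=
        Finset.sum_le_sum fun j hj => mul_log_le_chord (h₁ j hj) (h₂ j hj)
    _ = T * (Real.log w + Real.log 2 - w / (T / s.card) * Real.log 2) := by
        rw [Finset.sum_add_distrib, ← Finset.sum_mul, ← Finset.sum_mul, Finset.sum_sub_distrib,
          Finset.sum_const, nsmul_eq_mul, ← hTdef]
        field_simp
        ring
    _ ≤ T * (Real.log (T / s.card) + alphaConst * Real.log 2) := by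
        have hu : Real.log (w / (T / s.card) * Real.log 2) ≤ w / (T / s.card) * Real.log 2 - 1 :=
          Real.log_le_sub_one_of_pos (by positivity)
        rw [Real.log_mul (by positivity) hlog.ne', Real.log_div hw.ne' hmean.ne'] at hu
        rw [alphaConst_mul_log_two]
        gcongr
        linarith

theorem sum_mul_log_le_sum_mul_log {ι : Type*} {s : Finset ι} {a b : ι → ℝ}
    (ha : ∀ j ∈ s, 0 ≤ a j) (hb : ∀ j ∈ s, 0 ≤ b j) (hab : ∀ j ∈ s, 0 < a j → 0 < b j)
    (hsum : ∑ j ∈ s, b j ≤ ∑ j ∈ s, a j) :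
    ∑ j ∈ s, a j * Real.log (b j) ≤ ∑ j ∈ s, a j * Real.log (a j) := by
  have hterm : ∀ j ∈ s, a j * Real.log (b j) ≤ a j * Real.log (a j) + (b j - a j) := by
    intro j hj
    obtain h | h := (ha j hj).eq_or_lt
    · simpa [← h] using hb j hj
    have hlog := Real.log_le_sub_one_of_pos (div_pos (hab j hj h) h)
    rw [Real.log_div (hab j hj h).ne' h.ne'] at hlog
    calc a j * Real.log (b j) ≤ a j * (Real.log (a j) + (b j / a j - 1)) := by
          gcongr
          linarith
      _ = a j * Real.log (a j) + (b j - a j) := by field_simp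
  calc ∑ j ∈ s, a j * Real.log (b j)
      ≤ ∑ j ∈ s, a j * Real.log (a j) + (∑ j ∈ s, b j - ∑ j ∈ s, a j) := by
        simpa only [Finset.sum_add_distrib, Finset.sum_sub_distrib] using Finset.sum_le_sum hterm
    _ ≤ ∑ j ∈ s, a j * Real.log (a j) := by linarith

theorem sum_comp_le_sum_of_injOn {κ : Type*} [Fintype κ] {b : κ → ℝ} {c : ℝ} (hc : ∀ j, c ≤ b j)
    {e : κ → κ} (he : Set.InjOn e {l | b (e l) ≠ c}) : ∑ l, b (e l) ≤ ∑ j, b j := by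
  classical
  suffices h : ∑ l, (b (e l) - c) ≤ ∑ j, (b j - c) by
    simpa only [Finset.sum_sub_distrib, sub_le_sub_iff_right] using h
  calc ∑ l, (b (e l) - c) = ∑ l with b (e l) ≠ c, (b (e l) - c) :=
        (Finset.sum_filter_of_ne fun l _ h => sub_ne_zero.1 h).symm
    _ = ∑ j ∈ Finset.image e {l | b (e l) ≠ c}, (b j - c) :=
        (Finset.sum_image (f := fun j => b j - c) (by simpa using he)).symm
    _ ≤ ∑ j, (b j - c) :=
        Finset.sum_le_univ_sum_of_nonneg fun j => sub_nonneg.2 (hc j)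

theorem exists_rightInverse_forall_le {ι κ α : Type*} [Finite ι] [LinearOrder α] {g : ι → κ}
    (hg : Function.Surjective g) (σ : ι → α) :
    ∃ t : κ → ι, Function.RightInverse t g ∧ ∀ i, σ i ≤ σ (t (g i)) := by
  have hmax (l : κ) : ∃ i ∈ g ⁻¹' {l}, ∀ i' ∈ g ⁻¹' {l}, σ i' ≤ σ i :=
    Set.exists_max_image _ σ (Set.toFinite _) (hg l)
  choose t ht htmax using hmax
  exact ⟨t, ht, fun i => htmax (g i) i rfl⟩

section Levelling

variable {κ : Type*} [Fintype κ] {q : κ → ℝ} {w : ℝ}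

/-- The mean of those weights `q j` that are at most `w` (zero if there are none). -/
noncomputable def lightMean (w : ℝ) (q : κ → ℝ) : ℝ :=
  (∑ j with q j ≤ w, q j) / (Finset.univ.filter fun j => q j ≤ w).card

/-- The weights `q`, with all those that are at most `w` replaced by their mean. -/
noncomputable def levelled (w : ℝ) (q : κ → ℝ) (j : κ) : ℝ :=
  if q j ≤ w then lightMean w q else q j

theorem lightMean_nonneg (hq : ∀ j, 0 ≤ q j) : 0 ≤ lightMean w q :=
  div_nonneg (Finset.sum_nonneg fun j _ => hq j) (Nat.cast_nonneg _)

theorem lightMean_le_levelled (hq : ∀ j, 0 ≤ q j) (j : κ) : lightMean w q ≤ levelled w q j := by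
  rw [levelled]
  split_ifs with hj
  · exact le_rfl
  obtain hJ | hJ := (Finset.univ.filter fun k => q k ≤ w).eq_empty_or_nonempty
  · simpa [lightMean, hJ] using hq j
  · have hmean : lightMean w q ≤ w := by
      rw [lightMean, div_le_iff₀' (Nat.cast_pos.2 hJ.card_pos), ← nsmul_eq_mul]
      exact Finset.sum_le_card_nsmul _ _ _ fun k hk => (Finset.mem_filter.1 hk).2
    linarith

theorem levelled_pos (hq : ∀ j, 0 ≤ q j) {j : κ} (hj : 0 < q j) : 0 < levelled w q j := by
  rw [levelled]
  split_ifs with h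
  · have hmem : j ∈ Finset.univ.filter fun k => q k ≤ w := by simpa using h
    exact div_pos (hj.trans_le (Finset.single_le_sum (fun k _ => hq k) hmem))
      (Nat.cast_pos.2 (Finset.card_pos.2 ⟨j, hmem⟩))
  · exact hj

theorem sum_levelled (w : ℝ) (q : κ → ℝ) : ∑ j, levelled w q j = ∑ j, q j := by
  simp only [levelled]
  rw [Finset.sum_ite, Finset.sum_const, nsmul_eq_mul, lightMean, mul_div_cancel_of_imp',
    Finset.sum_filter_add_sum_filter_not]
  intro h
  rw [Finset.card_eq_zero.1 (Nat.cast_eq_zero.1 h), Finset.sum_empty]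

theorem sum_mul_log_le_sum_mul_log_levelled_add (hq : ∀ j, 0 ≤ q j) (hw : ∀ j, w / 2 ≤ q j) :
    ∑ j, q j * Real.log (q j) ≤
      ∑ j, q j * Real.log (levelled w q j) + alphaConst * Real.log 2 * ∑ j, q j := by
  have hα : 0 ≤ alphaConst * Real.log 2 :=
    mul_nonneg (by linarith [one_div_sixteen_le_alphaConst]) (Real.log_nonneg one_le_two)
  have hlight := sum_mul_log_le_mul_log_mean_add (s := Finset.univ.filter fun j => q j ≤ w)
    (fun j _ => hw j) fun j hj => (Finset.mem_filter.1 hj).2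
  have hmass := mul_le_mul_of_nonneg_left
    (Finset.sum_le_univ_sum_of_nonneg (s := Finset.univ.filter fun j => q j ≤ w) hq) hα
  have hlevelled : ∑ j, q j * Real.log (levelled w q j) =
      (∑ j with q j ≤ w, q j) * Real.log (lightMean w q) +
        ∑ j with ¬ q j ≤ w, q j * Real.log (q j) := by
    simp only [levelled, apply_ite Real.log, mul_ite]
    rw [Finset.sum_ite, Finset.sum_mul]
  rw [hlevelled, ← Finset.sum_filter_add_sum_filter_not Finset.univ (fun j => q j ≤ w)
    fun j => q j * Real.log (q j), lightMean]
  linarith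

end Levelling

section DistOfFun

variable {n m : ℕ} {p : Fin n → ℝ}

theorem sum_distOfFun_mul (p : Fin n → ℝ) (f : Fin n → Fin m) (h : Fin m → ℝ) :
    ∑ j, distOfFun p f j * h j = ∑ i, p i * h (f i) := by
  rw [← Finset.sum_fiberwise (g := f)]
  refine Finset.sum_congr rfl fun j _ => ?_
  rw [distOfFun, Finset.sum_mul]
  exact Finset.sum_congr rfl fun i hi => by rw [(Finset.mem_filter.1 hi).2]

theorem sum_distOfFun (p : Fin n → ℝ) (f : Fin n → Fin m) : ∑ j, distOfFun p f j = ∑ i, p i :=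
  Finset.sum_fiberwise ..

theorem le_distOfFun (hp : ∀ i, 0 ≤ p i) (f : Fin n → Fin m) (i : Fin n) :
    p i ≤ distOfFun p f (f i) :=
  Finset.single_le_sum (f := p) (fun i _ => hp i) (by simp)

theorem distOfFun_nonneg (hp : ∀ i, 0 ≤ p i) (f : Fin n → Fin m) (j : Fin m) :
    0 ≤ distOfFun p f j :=
  Finset.sum_nonneg fun i _ => hp i

theorem exists_pos_of_distOfFun_pos {f : Fin n → Fin m} {j : Fin m} (h : 0 < distOfFun p f j) :
    ∃ i, f i = j ∧ 0 < p i := by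
  simpa using Finset.exists_lt_of_sum_lt (s := Finset.univ.filter fun i => f i = j)
    (f := fun _ => (0 : ℝ)) (g := p) (by simpa [distOfFun] using h)

/-- In every fibre of `g` choose an outcome whose block of `f` has the largest levelled weight. As
the heavy blocks of `f` are singletons, the chosen weights have total mass at most one, so Gibbs'
inequality compares them with the distribution of `g`. -/
theorem sum_mul_log_levelled_le (hp : ∀ i, 0 ≤ p i) {f g : Fin n → Fin m}
    (hg : Function.Surjective g) {w : ℝ}
    (hheavy : ∀ i i', f i = f i' → w < distOfFun p f (f i) → i = i') :
    ∑ j, distOfFun p f j * Real.log (levelled w (distOfFun p f) j) ≤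
      ∑ j, distOfFun p g j * Real.log (distOfFun p g j) := by
  set ρ := levelled w (distOfFun p f)
  have hq := distOfFun_nonneg hp f
  have hρ : ∀ j, lightMean w (distOfFun p f) ≤ ρ j := lightMean_le_levelled hq
  have hρpos (i) (hi : 0 < p i) : 0 < ρ (f i) := levelled_pos hq (hi.trans_le (le_distOfFun hp f i))
  obtain ⟨t, htg, ht⟩ := exists_rightInverse_forall_le hg fun i => ρ (f i)
  have hmass : ∑ l, ρ (f (t l)) ≤ ∑ j, distOfFun p g j := by
    refine (sum_comp_le_sum_of_injOn hρ fun l hl l' _ hll' => ?_).trans_eq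
      (by rw [sum_levelled, sum_distOfFun, sum_distOfFun])
    have hw : w < distOfFun p f (f (t l)) := by
      by_contra! h
      exact hl (if_pos h)
    exact htg.injective (hheavy _ _ hll' hw)
  calc ∑ j, distOfFun p f j * Real.log (ρ j)
      = ∑ i, p i * Real.log (ρ (f i)) := sum_distOfFun_mul ..
    _ ≤ ∑ i, p i * Real.log (ρ (f (t (g i)))) := by
        refine Finset.sum_le_sum fun i _ => ?_
        obtain h | h := (hp i).eq_or_lt
        · simp [← h]
        · exact mul_le_mul_of_nonneg_left (Real.log_le_log (hρpos i h) (ht i)) h.le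
    _ = ∑ l, distOfFun p g l * Real.log (ρ (f (t l))) :=
        (sum_distOfFun_mul p g fun l => Real.log (ρ (f (t l)))).symm
    _ ≤ ∑ l, distOfFun p g l * Real.log (distOfFun p g l) := by
        refine sum_mul_log_le_sum_mul_log (fun l _ => distOfFun_nonneg hp g l)
          (fun l _ => (lightMean_nonneg hq).trans (hρ _)) (fun l _ hl => ?_) hmass
        obtain ⟨i, rfl, hi⟩ := exists_pos_of_distOfFun_pos hl
        exact (hρpos i hi).trans_le (ht i)

theorem shannonEntropy_mul_log_two {k : ℕ} (a : Fin k → ℝ) :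
    shannonEntropy a * Real.log 2 = -∑ i, a i * Real.log (a i) := by
  have hlog : Real.log 2 ≠ 0 := (Real.log_pos one_lt_two).ne'
  simp only [shannonEntropy, Real.logb, neg_mul, Finset.sum_mul]
  exact congrArg Neg.neg (Finset.sum_congr rfl fun i _ => by field_simp)

theorem shannonEntropy_distOfFun_sub_le (hp : ∀ i, 0 ≤ p i) {f g : Fin n → Fin m}
    (hg : Function.Surjective g) {w : ℝ} (hw : ∀ j, w / 2 ≤ distOfFun p f j)
    (hheavy : ∀ i i', f i = f i' → w < distOfFun p f (f i) → i = i') :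
    shannonEntropy (distOfFun p g) - alphaConst * ∑ i, p i ≤ shannonEntropy (distOfFun p f) := by
  have h₁ := sum_mul_log_le_sum_mul_log_levelled_add (distOfFun_nonneg hp f) hw
  have h₂ := sum_mul_log_levelled_le hp hg hheavy
  refine le_of_mul_le_mul_right ?_ (Real.log_pos one_lt_two)
  rw [sub_mul, shannonEntropy_mul_log_two, shannonEntropy_mul_log_two]
  rw [sum_distOfFun] at h₁
  linarith

theorem exists_isGreatest_entropyValues (p : Fin n → ℝ) {f : Fin n → Fin m}
    (hf : Function.Surjective f) : ∃ M, IsGreatest (entropyValues m p) M := by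
  have hfin : (entropyValues m p).Finite :=
    (Set.finite_range fun f : Fin n → Fin m => shannonEntropy (distOfFun p f)).subset <| by
      rintro _ ⟨f, -, rfl⟩
      exact ⟨f, rfl⟩
  obtain ⟨M, hM, hmax⟩ := Set.exists_max_image _ id hfin ⟨_, f, hf, rfl⟩
  exact ⟨M, hM, hmax⟩

end DistOfFun

section HuffmanBound

variable {n m : ℕ} {p : Fin n → ℝ}

/-- The threshold is the weight of the last block formed: block weights formed along a run never
decrease, and that block weighs at most twice as much as the two smallest blocks it came from. -/
theorem HuffmanRun.exists_threshold (hp : ∀ i, 0 ≤ p i) {k : ℕ} {C : Finset (Finset (Fin n))}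
    (h : HuffmanRun p k C) :
    ∃ w : ℝ, ∀ D ∈ C, w / 2 ≤ ∑ i ∈ D, p i ∧ (w < ∑ i ∈ D, p i → ∃ i, D = {i}) := by
  induction h with
  | zero =>
    refine ⟨0, Finset.forall_mem_image.2 fun i _ => ?_⟩
    simp [hp i]
  | succ _ hstep ih =>
    obtain ⟨w, hw⟩ := ih
    obtain ⟨A, hA, B, hB, -, hmin, rfl⟩ := hstep
    have hunion : ∑ i ∈ A ∪ B, p i ≤ ∑ i ∈ A, p i + ∑ i ∈ B, p i := by
      rw [← Finset.sum_union_inter]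
      exact le_add_of_nonneg_right (Finset.sum_nonneg fun i _ => hp i)
    have hsubA : ∑ i ∈ A, p i ≤ ∑ i ∈ A ∪ B, p i :=
      Finset.sum_le_sum_of_subset_of_nonneg Finset.subset_union_left fun i _ _ => hp i
    have hsubB : ∑ i ∈ B, p i ≤ ∑ i ∈ A ∪ B, p i :=
      Finset.sum_le_sum_of_subset_of_nonneg Finset.subset_union_right fun i _ _ => hp i
    refine ⟨∑ i ∈ A, p i + ∑ i ∈ B, p i, Finset.forall_mem_insert .. |>.2
      ⟨⟨by linarith, fun h => absurd h hunion.not_gt⟩, fun D hD => ?_⟩⟩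
    simp only [Finset.mem_erase] at hD
    obtain ⟨hDB, hDA, hDC⟩ := hD
    have hD := hmin D hDC hDA hDB
    exact ⟨by linarith, fun h => (hw D hDC).2 (by linarith [hw A hA, hw B hB])⟩

theorem IsHuffmanFun.entropy_bounds (hp : p ∈ stdSimplex ℝ (Fin n)) {f : Fin n → Fin m}
    (hf : IsHuffmanFun p f) {M : ℝ} (hM : IsGreatest (entropyValues m p) M) :
    M - alphaConst ≤ shannonEntropy (distOfFun p f) ∧ shannonEntropy (distOfFun p f) ≤ M := by
  obtain ⟨⟨g, hg, rfl⟩, hmax⟩ := hM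
  obtain ⟨w, hw⟩ := hf.2.exists_threshold hp.1
  replace hw := fun j => Finset.forall_mem_image.1 hw (Finset.mem_univ j)
  refine ⟨?_, hmax ⟨f, hf.1, rfl⟩⟩
  refine (shannonEntropy_distOfFun_sub_le hp.1 hg (fun j => (hw j).1) fun i i' hii' hi => ?_).trans'
    (by rw [hp.2, mul_one])
  obtain ⟨i₀, hi₀⟩ := (hw (f i)).2 hi
  have hfibre (k : Fin n) (hk : f k = f i) : k = i₀ :=
    Finset.mem_singleton.1 (hi₀ ▸ Finset.mem_filter.2 ⟨Finset.mem_univ k, hk⟩)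
  rw [hfibre i rfl, hfibre i' hii'.symm]

end HuffmanBound

section Labelling

variable {n q r : ℕ} {p : Fin n → ℝ} {F : Fin n → ℕ}

/-- The block of the outcomes with label `j`. Labels are plain natural numbers, so that their range
may shrink while a program runs. -/
def labelBlock (F : Fin n → ℕ) (j : ℕ) : Finset (Fin n) :=
  Finset.univ.filter fun i => F i = j

/-- The family of the blocks with labels below `r`. -/
def labelBlocks (F : Fin n → ℕ) (r : ℕ) : Finset (Finset (Fin n)) :=
  (Finset.range r).image (labelBlock F)

/-- The labels in use are exactly those below `r`; the blocks of `F` then form a partition of the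
outcomes into `r` nonempty sets. -/
def IsLabelling (F : Fin n → ℕ) (r : ℕ) : Prop :=
  Set.range F = Set.Iio r

theorem IsLabelling.lt (h : IsLabelling F r) (i : Fin n) : F i < r :=
  h.subset ⟨i, rfl⟩

theorem IsLabelling.exists_eq (h : IsLabelling F r) {j : ℕ} (hj : j < r) : ∃ i, F i = j :=
  h.superset hj

theorem mem_labelBlock {j : ℕ} {i : Fin n} : i ∈ labelBlock F j ↔ F i = j := by
  simp [labelBlock]

theorem disjoint_labelBlock (F : Fin n → ℕ) {j j' : ℕ} (h : j ≠ j') :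
    Disjoint (labelBlock F j) (labelBlock F j') :=
  Finset.disjoint_filter.2 fun _ _ hj hj' => h (hj.symm.trans hj')

theorem IsLabelling.labelBlock_injOn (h : IsLabelling F r) :
    Set.InjOn (labelBlock F) (Set.Iio r) := by
  intro j hj j' _ hjj'
  obtain ⟨i, rfl⟩ := h.exists_eq hj
  exact mem_labelBlock.1 (hjj' ▸ mem_labelBlock.2 rfl)

theorem labelBlock_swap_comp (A B : ℕ) (F : Fin n → ℕ) (j : ℕ) :
    labelBlock (Equiv.swap A B ∘ F) j = labelBlock F (Equiv.swap A B j) := by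
  ext i
  simp [mem_labelBlock, Equiv.swap_apply_eq_iff]

theorem swap_bijOn_Iio {A B : ℕ} (hA : A < r) (hB : B < r) :
    Set.BijOn (Equiv.swap A B) (Set.Iio r) (Set.Iio r) :=
  Equiv.swap_bijOn_self (iff_of_true hA hB)

theorem labelBlocks_swap_comp {A B : ℕ} (hA : A < r) (hB : B < r) (F : Fin n → ℕ) :
    labelBlocks (Equiv.swap A B ∘ F) r = labelBlocks F r := by
  rw [labelBlocks, labelBlocks, ← Finset.coe_inj, Finset.coe_image, Finset.coe_image,
    Finset.coe_range, funext (labelBlock_swap_comp A B F), ← Set.image_image (labelBlock F),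
    (swap_bijOn_Iio hA hB).image_eq]

theorem IsLabelling.swap_comp (h : IsLabelling F r) {A B : ℕ} (hA : A < r) (hB : B < r) :
    IsLabelling (Equiv.swap A B ∘ F) r := by
  rw [IsLabelling, Set.range_comp, h, (swap_bijOn_Iio hA hB).image_eq]

theorem IsLabelling.merge (h : IsLabelling F (q + 1)) {B : ℕ} (hB : B < q) :
    IsLabelling (Function.update id q B ∘ F) q := by
  rw [IsLabelling, Set.range_comp, h]
  ext j
  simp only [Set.mem_image, Set.mem_Iio, Function.update_apply, id]
  exact ⟨by grind, fun hj => ⟨j, by grind⟩⟩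

theorem labelBlock_merge {B j : ℕ} (hj : j < q) :
    labelBlock (Function.update id q B ∘ F) j =
      if j = B then labelBlock F q ∪ labelBlock F B else labelBlock F j := by
  ext i
  split_ifs <;> simp only [mem_labelBlock, Finset.mem_union, Function.comp, Function.update_apply,
    id] <;> grind

theorem IsLabelling.labelBlocks_merge (h : IsLabelling F (q + 1)) {B : ℕ} (hB : B < q) :
    labelBlocks (Function.update id q B ∘ F) q = insert (labelBlock F q ∪ labelBlock F B)
      (((labelBlocks F (q + 1)).erase (labelBlock F q)).erase (labelBlock F B)) := by
  have hinj {j j'} (hj : j ≤ q) (hj' : j' ≤ q) : labelBlock F j = labelBlock F j' ↔ j = j' :=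
    h.labelBlock_injOn.eq_iff (Nat.lt_succ_of_le hj) (Nat.lt_succ_of_le hj')
  have herase : ((labelBlocks F (q + 1)).erase (labelBlock F q)).erase (labelBlock F B) =
      ((Finset.range q).erase B).image (labelBlock F) := by
    ext D
    simp only [labelBlocks, Finset.mem_erase, Finset.mem_image, Finset.mem_range]
    grind
  rw [herase, labelBlocks]
  nth_rw 1 [← Finset.insert_erase (Finset.mem_range.2 hB)]
  rw [Finset.image_insert, labelBlock_merge hB, if_pos rfl]
  refine congrArg _ (Finset.image_congr fun j hj => ?_)
  obtain ⟨hjB, hjq⟩ := Finset.mem_erase.1 hj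
  rw [labelBlock_merge (Finset.mem_range.1 hjq), if_neg hjB]

theorem IsLabelling.huffmanStep_merge (h : IsLabelling F (q + 1)) {B : ℕ} (hB : B < q)
    (hq_min : ∀ j < q, ∑ i ∈ labelBlock F q, p i ≤ ∑ i ∈ labelBlock F j, p i)
    (hB_min : ∀ j < q, ∑ i ∈ labelBlock F B, p i ≤ ∑ i ∈ labelBlock F j, p i) :
    HuffmanStep p (labelBlocks F (q + 1)) (labelBlocks (Function.update id q B ∘ F) q) := by
  have hmem {j} (hj : j < q + 1) : labelBlock F j ∈ labelBlocks F (q + 1) :=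
    Finset.mem_image_of_mem _ (Finset.mem_range.2 hj)
  have hB' : B < q + 1 := hB.trans q.lt_succ_self
  refine ⟨labelBlock F q, hmem q.lt_succ_self, labelBlock F B, hmem hB',
    h.labelBlock_injOn.ne q.lt_succ_self hB' hB.ne', ?_, h.labelBlocks_merge hB⟩
  simp only [labelBlocks, Finset.forall_mem_image, Finset.mem_range, Nat.lt_succ_iff_lt_or_eq]
  rintro j (hj | rfl) hjq -
  · exact ⟨hq_min j hj, hB_min j hj⟩
  · exact absurd rfl hjq

theorem IsLabelling.exists_huffmanStep (h : IsLabelling F (q + 1)) (hq : 0 < q) (p : Fin n → ℝ) :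
    ∃ F' : Fin n → ℕ, IsLabelling F' q ∧
      HuffmanStep p (labelBlocks F (q + 1)) (labelBlocks F' q) := by
  obtain ⟨A, hA, hA_min⟩ := (Finset.range (q + 1)).exists_min_image
    (fun j => ∑ i ∈ labelBlock F j, p i) ⟨0, by simp⟩
  simp only [Finset.mem_range] at hA hA_min
  have h' := h.swap_comp hA q.lt_succ_self
  obtain ⟨B, hB, hB_min⟩ := (Finset.range q).exists_min_image
    (fun j => ∑ i ∈ labelBlock (Equiv.swap A q ∘ F) j, p i) ⟨0, by simpa⟩
  simp only [Finset.mem_range] at hB hB_min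
  refine ⟨_, h'.merge hB, ?_⟩
  rw [← labelBlocks_swap_comp hA q.lt_succ_self F]
  refine h'.huffmanStep_merge hB (fun j hj => ?_) hB_min
  rw [labelBlock_swap_comp, labelBlock_swap_comp, Equiv.swap_apply_right]
  exact hA_min _ ((swap_bijOn_Iio hA q.lt_succ_self).mapsTo (Nat.lt_succ_of_lt hj))

theorem isLabelling_val (n : ℕ) : IsLabelling (Fin.val : Fin n → ℕ) n :=
  Fin.range_val

theorem labelBlock_val (i : Fin n) : labelBlock (Fin.val : Fin n → ℕ) i = {i} := by
  ext i'
  simp [mem_labelBlock, Fin.ext_iff]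

theorem image_labelBlock_val (F : Fin n → ℕ) (r : ℕ) :
    (Finset.univ.image fun j : Fin r => labelBlock F j) = labelBlocks F r := by
  ext D
  simp [labelBlocks, Fin.exists_iff]

theorem labelBlocks_val (n : ℕ) :
    labelBlocks (Fin.val : Fin n → ℕ) n = Finset.univ.image fun i => {i} := by
  simp only [← image_labelBlock_val, labelBlock_val]

theorem exists_huffmanRun {m : ℕ} (hm : 0 < m) (hmn : m ≤ n) (p : Fin n → ℝ) :
    ∃ F : Fin n → ℕ, IsLabelling F m ∧ HuffmanRun p (n - m) (labelBlocks F m) := by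
  induction hmn using Nat.decreasingInduction with
  | self => exact ⟨_, isLabelling_val n, by rw [labelBlocks_val, Nat.sub_self]; exact .zero⟩
  | of_succ m hmn ih =>
    obtain ⟨F, hF, hrun⟩ := ih m.succ_pos
    obtain ⟨F', hF', hstep⟩ := hF.exists_huffmanStep hm p
    have hsteps : n - m = n - (m + 1) + 1 := by omega
    exact ⟨F', hF', hsteps ▸ hrun.succ hstep⟩

/-- A labelling as a function to `Fin r`. -/
def IsLabelling.toFin (h : IsLabelling F r) (i : Fin n) : Fin r :=
  ⟨F i, h.lt i⟩

theorem IsLabelling.isHuffmanFun_toFin (h : IsLabelling F r)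
    (hrun : HuffmanRun p (n - r) (labelBlocks F r)) : IsHuffmanFun p h.toFin := by
  refine ⟨fun j => ?_, ?_⟩
  · obtain ⟨i, hi⟩ := h.exists_eq j.2
    exact ⟨i, Fin.ext hi⟩
  · simpa only [← image_labelBlock_val, labelBlock, IsLabelling.toFin, Fin.ext_iff] using hrun

theorem exists_isHuffmanFun {m : ℕ} (hm : 0 < m) (hmn : m ≤ n) (p : Fin n → ℝ) :
    ∃ f : Fin n → Fin m, IsHuffmanFun p f := by
  obtain ⟨F, hF, hrun⟩ := exists_huffmanRun hm hmn p
  exact ⟨_, hF.isHuffmanFun_toFin hrun⟩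

end Labelling

section Scaling

variable {n : ℕ} {p : Fin n → ℝ} {c : ℝ}

theorem HuffmanStep.div_const (hc : 0 ≤ c) {C C' : Finset (Finset (Fin n))}
    (h : HuffmanStep p C C') : HuffmanStep (fun i => p i / c) C C' := by
  obtain ⟨A, hA, B, hB, hAB, hmin, hC'⟩ := h
  refine ⟨A, hA, B, hB, hAB, fun D hD hDA hDB => ?_, hC'⟩
  simp only [← Finset.sum_div]
  exact (hmin D hD hDA hDB).imp (div_le_div_of_nonneg_right · hc)
    (div_le_div_of_nonneg_right · hc)

theorem HuffmanRun.div_const (hc : 0 ≤ c) {k : ℕ} {C : Finset (Finset (Fin n))}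
    (h : HuffmanRun p k C) : HuffmanRun (fun i => p i / c) k C := by
  induction h with
  | zero => exact .zero
  | succ _ hstep ih => exact ih.succ (hstep.div_const hc)

end Scaling

section EntropyApproximation

variable {m k D : ℕ} {w : Fin m → ℕ}

/-- `D k` times an approximation of the entropy of the distribution `w / D`, computed by counting
binary digits of `k`-th powers. The summand `1` turns the approximation into an upper bound and
thereby keeps the difference from being truncated. -/
def entropyNumerator (k D : ℕ) (w : Fin m → ℕ) : ℕ :=
  ((D ^ k).size + 1) * D - ∑ j, (w j ^ k).size * w j

theorem logb_two_le_size (a : ℕ) : Real.logb 2 a ≤ a.size := by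
  obtain rfl | ha := a.eq_zero_or_pos
  · simp
  rw [Real.logb_le_iff_le_rpow one_lt_two (Nat.cast_pos.2 ha), Real.rpow_natCast]
  exact_mod_cast a.lt_size_self.le

theorem size_le_logb_two_add_one {a : ℕ} (ha : 0 < a) : (a.size : ℝ) ≤ Real.logb 2 a + 1 := by
  obtain ⟨z, hz⟩ := Nat.exists_eq_add_one_of_ne_zero (Nat.size_pos.2 ha).ne'
  have hpow : 2 ^ z ≤ a := Nat.lt_size.1 (by omega)
  rw [hz, Nat.cast_succ, add_le_add_iff_right, Real.le_logb_iff_rpow_le one_lt_two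
    (Nat.cast_pos.2 ha), Real.rpow_natCast]
  exact_mod_cast hpow

theorem mul_logb_two_le_size_pow_mul (k a : ℕ) :
    k * (a * Real.logb 2 a) ≤ (a ^ k).size * a := by
  have h := mul_le_mul_of_nonneg_right (logb_two_le_size (a ^ k)) a.cast_nonneg
  rw [Nat.cast_pow, Real.logb_pow] at h
  linarith

theorem size_pow_mul_le_mul_logb_two_add (k a : ℕ) :
    (a ^ k).size * a ≤ k * (a * Real.logb 2 a) + a := by
  obtain rfl | ha := a.eq_zero_or_pos
  · simp
  have h := mul_le_mul_of_nonneg_right (size_le_logb_two_add_one (pow_pos ha k)) a.cast_nonneg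
  rw [Nat.cast_pow, Real.logb_pow] at h
  linarith

theorem shannonEntropy_div_mul (hD : 0 < D) (hsum : ∑ j, w j = D) :
    shannonEntropy (fun j => (w j : ℝ) / D) * D =
      D * Real.logb 2 D - ∑ j, w j * Real.logb 2 (w j) := by
  have hD' : (D : ℝ) ≠ 0 := Nat.cast_ne_zero.2 hD.ne'
  have hterm (j : Fin m) : (w j : ℝ) / D * Real.logb 2 (w j / D) * D =
      w j * Real.logb 2 (w j) - w j * Real.logb 2 D := by
    obtain h | h := (w j).eq_zero_or_pos
    · simp [h]
    · rw [Real.logb_div (Nat.cast_ne_zero.2 h.ne') hD']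
      field_simp
  rw [shannonEntropy, neg_mul, Finset.sum_mul, Finset.sum_congr rfl fun j _ => hterm j,
    Finset.sum_sub_distrib, ← Finset.sum_mul, ← Nat.cast_sum, hsum, neg_sub]

theorem sum_size_pow_mul_le (k : ℕ) (hsum : ∑ j, w j = D) :
    ∑ j, (w j ^ k).size * w j ≤ (D ^ k).size * D := by
  rw [← hsum, Finset.mul_sum]
  gcongr with j hj
  exact Nat.size_le_size (Nat.pow_le_pow_left (Finset.single_le_sum_of_canonicallyOrdered hj) k)

theorem entropyNumerator_div_mem_Icc (hk : 0 < k) (hD : 0 < D) (hsum : ∑ j, w j = D) :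
    (entropyNumerator k D w : ℝ) / (D * k : ℕ) ∈
      Set.Icc (shannonEntropy fun j => (w j : ℝ) / D)
        (shannonEntropy (fun j => (w j : ℝ) / D) + 2 / k) := by
  have hpos : (0 : ℝ) < D * k := by positivity
  have hH := shannonEntropy_div_mul hD hsum
  set H := shannonEntropy fun j => (w j : ℝ) / D
  have hlower : k * ∑ j, w j * Real.logb 2 (w j) ≤ ∑ j, ((w j ^ k).size : ℝ) * w j := by
    rw [Finset.mul_sum]
    exact Finset.sum_le_sum fun j _ => mul_logb_two_le_size_pow_mul k (w j)
  have hupper : ∑ j, ((w j ^ k).size : ℝ) * w j ≤ k * ∑ j, w j * Real.logb 2 (w j) + D := by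
    rw [← hsum, Nat.cast_sum, Finset.mul_sum, ← Finset.sum_add_distrib]
    exact Finset.sum_le_sum fun j _ => size_pow_mul_le_mul_logb_two_add k (w j)
  have hDlower := mul_logb_two_le_size_pow_mul k D
  have hDupper := size_pow_mul_le_mul_logb_two_add k D
  have hle : ∑ j, (w j ^ k).size * w j ≤ ((D ^ k).size + 1) * D :=
    (sum_size_pow_mul_le k hsum).trans (Nat.mul_le_mul_right _ (Nat.le_succ _))
  have hcast : (entropyNumerator k D w : ℝ) =
      (D ^ k).size * D + D - ∑ j, ((w j ^ k).size : ℝ) * w j := by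
    rw [entropyNumerator, Nat.cast_sub hle]
    push_cast
    ring
  rw [Nat.cast_mul, hcast]
  constructor
  · rw [le_div_iff₀ hpos, ← mul_assoc, hH]
    linarith
  · rw [div_le_iff₀ hpos, add_mul, ← mul_assoc, hH, div_mul_comm]
    field_simp
    linarith

end EntropyApproximation

namespace RAM

infixr:60 " ;; " => Prog.seq

@[grind =]
theorem State.setReg_reg (s : State) (x v y : ℕ) :
    (s.setReg x v).reg y = if y = x then v else s.reg y :=
  Function.update_apply ..

@[grind =]
theorem State.setReg_arr (s : State) (x v a i : ℕ) : (s.setReg x v).arr a i = s.arr a i := rfl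

@[grind =]
theorem State.setArr_reg (s : State) (a i v x : ℕ) : (s.setArr a i v).reg x = s.reg x := rfl

@[grind =]
theorem State.setArr_arr (s : State) (a i v b j : ℕ) :
    (s.setArr a i v).arr b j = if b = a ∧ j = i then v else s.arr b j := by
  simp only [State.setArr, Function.update_apply]
  grind

/-- All the numbers in registers and arrays are below `W`. -/
def State.Bounded (W : ℕ) (s : State) : Prop :=
  (∀ x, s.reg x < W) ∧ ∀ a i, s.arr a i < W

theorem State.Bounded.setReg {W : ℕ} {s : State} (h : s.Bounded W) {v : ℕ} (hv : v < W) (x : ℕ) :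
    (s.setReg x v).Bounded W :=
  ⟨fun y => by rw [setReg_reg]; split_ifs; exacts [hv, h.1 y], h.2⟩

theorem State.Bounded.setArr {W : ℕ} {s : State} (h : s.Bounded W) {v : ℕ} (hv : v < W)
    (a i : ℕ) : (s.setArr a i v).Bounded W :=
  ⟨h.1, fun b j => by rw [setArr_arr]; split_ifs; exacts [hv, h.2 b j]⟩

/-- The total correctness triple used to verify programs: started in `s`, the program `P` executes
at most `k` instructions and tests, and halts in a state satisfying `Q`; if all the numbers in `s`
are below `W`, they remain so. Each instruction touches at most three numbers, so it costs at most
`1 + 3 * W.size`. -/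
def Runs (W k : ℕ) (P : Prog) (s : State) (Q : State → Prop) : Prop :=
  s.Bounded W → ∃ t s', Exec P s t s' ∧ t ≤ k * (1 + 3 * W.size) ∧ s'.Bounded W ∧ Q s'

section Rules

variable {W k k' : ℕ} {P P' : Prog} {s : State} {Q R : State → Prop} {x y z a c : ℕ} {o : Op}

theorem Runs.mono (h : Runs W k P s R) (hk : k ≤ k') (hQ : ∀ s', R s' → Q s') :
    Runs W k' P s Q := by
  intro hs
  obtain ⟨t, s', hexec, ht, hs', hR⟩ := h hs
  exact ⟨t, s', hexec, ht.trans (Nat.mul_le_mul_right _ hk), hs', hQ s' hR⟩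

theorem Runs.skip (h : Q s) : Runs W 1 .skip s Q :=
  fun hs => ⟨1, s, .skip s, by omega, hs, h⟩

theorem Runs.const (hc : c < W) (h : Q (s.setReg x c)) : Runs W 1 (.const x c) s Q := by
  intro hs
  refine ⟨_, _, .const s x c, ?_, hs.setReg hc x, h⟩
  have := Nat.size_le_size hc.le
  omega

theorem Runs.op (hv : s.Bounded W → o.eval (s.reg y) (s.reg z) < W)
    (h : Q (s.setReg x (o.eval (s.reg y) (s.reg z)))) : Runs W 1 (.op o x y z) s Q := by
  intro hs
  refine ⟨_, _, .op s o x y z, ?_, hs.setReg (hv hs) x, h⟩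
  have := Nat.size_le_size (hv hs).le
  have := Nat.size_le_size (hs.1 y).le
  have := Nat.size_le_size (hs.1 z).le
  omega

theorem Runs.load (h : Q (s.setReg x (s.arr a (s.reg y)))) : Runs W 1 (.load x a y) s Q := by
  intro hs
  refine ⟨_, _, .load s x a y, ?_, hs.setReg (hs.2 _ _) x, h⟩
  have := Nat.size_le_size (hs.1 y).le
  have := Nat.size_le_size (hs.2 a (s.reg y)).le
  omega

theorem Runs.store (h : Q (s.setArr a (s.reg x) (s.reg y))) : Runs W 1 (.store a x y) s Q := by
  intro hs
  refine ⟨_, _, .store s a x y, ?_, hs.setArr (hs.1 _) _ _, h⟩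
  have := Nat.size_le_size (hs.1 x).le
  have := Nat.size_le_size (hs.1 y).le
  omega

theorem Runs.seq (h : Runs W k P s fun s' => Runs W k' P' s' Q) :
    Runs W (k + k') (P ;; P') s Q := by
  intro hs
  obtain ⟨t, s', hexec, ht, hs', hrun⟩ := h hs
  obtain ⟨u, s'', hexec', hu, hs'', hQ⟩ := hrun hs'
  exact ⟨_, s'', .seq hexec hexec', by rw [add_mul]; omega, hs'', hQ⟩

theorem Runs.call_seq (h : Runs W k P s R) (h' : ∀ s', R s' → Runs W k' P' s' Q) :
    Runs W (k + k') (P ;; P') s Q :=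
  .seq (h.mono le_rfl h')

theorem Runs.const_seq (hc : c < W) (h : Runs W k P (s.setReg x c) Q) :
    Runs W (k + 1) (.const x c ;; P) s Q :=
  add_comm k 1 ▸ .seq (.const hc h)

theorem Runs.op_seq (hv : s.Bounded W → o.eval (s.reg y) (s.reg z) < W)
    (h : Runs W k P (s.setReg x (o.eval (s.reg y) (s.reg z))) Q) :
    Runs W (k + 1) (.op o x y z ;; P) s Q :=
  add_comm k 1 ▸ .seq (.op hv h)

theorem Runs.load_seq (h : Runs W k P (s.setReg x (s.arr a (s.reg y))) Q) :
    Runs W (k + 1) (.load x a y ;; P) s Q :=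
  add_comm k 1 ▸ .seq (.load h)

theorem Runs.store_seq (h : Runs W k P (s.setArr a (s.reg x) (s.reg y)) Q) :
    Runs W (k + 1) (.store a x y ;; P) s Q :=
  add_comm k 1 ▸ .seq (.store h)

theorem Runs.ite (h : s.reg x < s.reg y → Runs W k P s Q)
    (h' : ¬ s.reg x < s.reg y → Runs W k P' s Q) : Runs W (k + 1) (.ite x y P P') s Q := by
  intro hs
  have := Nat.size_le_size (hs.1 x).le
  have := Nat.size_le_size (hs.1 y).le
  by_cases hxy : s.reg x < s.reg y
  · obtain ⟨t, s', hexec, ht, hs', hQ⟩ := h hxy hs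
    exact ⟨_, s', .ite_true hxy hexec, by rw [add_mul]; omega, hs', hQ⟩
  · obtain ⟨t, s', hexec, ht, hs', hQ⟩ := h' hxy hs
    exact ⟨_, s', .ite_false hxy hexec, by rw [add_mul]; omega, hs', hQ⟩

theorem Runs.while_false (hxy : ¬ s.reg x < s.reg y) (h : Q s) : Runs W 1 (.while x y P) s Q := by
  intro hs
  have := Nat.size_le_size (hs.1 x).le
  have := Nat.size_le_size (hs.1 y).le
  exact ⟨_, s, .while_false hxy, by omega, hs, h⟩

theorem Runs.while_true (hxy : s.reg x < s.reg y)
    (h : Runs W k P s fun s' => Runs W k' (.while x y P) s' Q) :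
    Runs W (k + k' + 1) (.while x y P) s Q := by
  intro hs
  have := Nat.size_le_size (hs.1 x).le
  have := Nat.size_le_size (hs.1 y).le
  obtain ⟨t, s', hexec, ht, hs', hrun⟩ := h hs
  obtain ⟨u, s'', hexec', hu, hs'', hQ⟩ := hrun hs'
  exact ⟨_, s'', .while_true hxy hexec hexec', by rw [add_mul, add_mul]; omega, hs'', hQ⟩

theorem Runs.while {N : ℕ} {I : ℕ → State → Prop} (h0 : I 0 s)
    (hend : ∀ s, I N s → ¬ s.reg x < s.reg y)
    (hstep : ∀ j < N, ∀ s, I j s → s.reg x < s.reg y ∧ Runs W k P s (I (j + 1))) :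
    Runs W (N * (k + 1) + 1) (.while x y P) s (I N) := by
  suffices H : ∀ d j s, j + d = N → I j s → Runs W (d * (k + 1) + 1) (.while x y P) s (I N) from
    H N 0 s (zero_add N) h0
  intro d
  induction d with
  | zero =>
    rintro j s rfl hI
    exact (Runs.while_false (hend s hI) hI).mono (by omega) fun _ => id
  | succ d ih =>
    intro j s hj hI
    obtain ⟨hxy, hrun⟩ := hstep j (by omega) s hI
    exact (Runs.while_true hxy (hrun.mono le_rfl fun s' hI' => ih (j + 1) s' (by omega) hI')).mono
      (by linarith) fun _ => id

end Rules

/-- The loop `for i = 0, …, y - 1 do P`, where `y` is a register; register `2` is assumed to hold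
the constant `1`. -/
def forLoop (i y : ℕ) (P : Prog) : Prog :=
  .const i 0 ;; .while i y (P ;; .op .add i i 2)

theorem Runs.forLoop {W k N i y : ℕ} {P : Prog} {s : State} {I : ℕ → State → Prop} (hN : N < W)
    (h0 : I 0 (s.setReg i 0)) (hreg : ∀ j s, I j s → s.reg i = j ∧ s.reg y = N)
    (hstep : ∀ j < N, ∀ s, I j s → Runs W k P s fun s' =>
      s'.reg i = j ∧ s'.reg 2 = 1 ∧ I (j + 1) (s'.setReg i (j + 1))) :
    Runs W (N * (k + 2) + 2) (forLoop i y P) s (I N) := by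
  refine Runs.const_seq (by omega) (Runs.while h0 (fun s hI => ?_) fun j hj s hI => ⟨?_, ?_⟩)
  · have := hreg N s hI
    omega
  · have := hreg j s hI
    omega
  · refine Runs.call_seq (hstep j hj s hI) fun s' ⟨hi, hone, hI'⟩ => Runs.op (fun _ => ?_) ?_
    · rw [hi, hone]
      exact (Nat.succ_le_of_lt hj).trans_lt hN
    · rwa [hi, hone]


/-- The assignment `x := y`; register `3` is assumed to hold the constant `0`. -/
def copy (x y : ℕ) : Prog := .op .add x y 3

theorem Runs.copy {W x y : ℕ} {s : State} {Q : State → Prop} (h3 : s.reg 3 = 0)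
    (h : Q (s.setReg x (s.reg y))) : Runs W 1 (copy x y) s Q :=
  .op (fun hs => by simpa only [Op.eval, h3, add_zero] using hs.1 y)
    (by simpa only [Op.eval, h3, add_zero] using h)

theorem Runs.copy_seq {W k x y : ℕ} {P : Prog} {s : State} {Q : State → Prop} (h3 : s.reg 3 = 0)
    (h : Runs W k P (s.setReg x (s.reg y)) Q) : Runs W (k + 1) (RAM.copy x y ;; P) s Q :=
  add_comm k 1 ▸ .seq (.copy h3 h)

/-- If `x = y` then `P` else `Q`. -/
def ifEq (x y : ℕ) (P Q : Prog) : Prog := .ite x y Q (.ite y x Q P)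

theorem Runs.ifEq {W k x y : ℕ} {P P' : Prog} {s : State} {Q : State → Prop}
    (h : s.reg x = s.reg y → Runs W k P s Q) (h' : s.reg x ≠ s.reg y → Runs W k P' s Q) :
    Runs W (k + 2) (ifEq x y P P') s Q :=
  .ite (fun hlt => (h' hlt.ne).mono k.le_succ fun _ => id) fun hge =>
    .ite (fun hlt => h' hlt.ne') fun hle => h (le_antisymm (not_lt.1 hle) (not_lt.1 hge))

/-- Puts into register `20` an index below register `8` at which array `2` is least. -/
def argmin : Prog :=
  .const 20 0 ;; forLoop 21 8 (.load 22 2 21 ;; .load 23 2 20 ;; .ite 22 23 (copy 20 21) .skip)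

theorem Runs.argmin {W r : ℕ} {s : State} (hr : 0 < r) (hrW : r < W) (h2 : s.reg 2 = 1)
    (h3 : s.reg 3 = 0) (h8 : s.reg 8 = r) :
    Runs W (r * 6 + 3) argmin s fun s' => (∀ x < 20, s'.reg x = s.reg x) ∧
      (∀ a i, s'.arr a i = s.arr a i) ∧ s'.reg 20 < r ∧
      ∀ j < r, s.arr 2 (s'.reg 20) ≤ s.arr 2 j := by
  refine .const_seq (by omega) ((Runs.forLoop (N := r) (k := 4) (I := fun j s' =>
    (∀ x < 20, s'.reg x = s.reg x) ∧ (∀ a i, s'.arr a i = s.arr a i) ∧ s'.reg 21 = j ∧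
      s'.reg 20 < r ∧ ∀ j' < j, s.arr 2 (s'.reg 20) ≤ s.arr 2 j') hrW
    (by grind) (by grind) ?_).mono le_rfl (by grind))
  intro j _ s' _
  refine .load_seq (.load_seq (.ite (fun _ => .copy (by grind) ?_) fun _ => .skip ?_)) <;> grind

/-- Replaces every entry of array `0` by its image under the map that `B` computes in place in
register `22`. -/
def mapLabels (B : Prog) : Prog :=
  forLoop 21 0 (.load 22 0 21 ;; B ;; .store 0 21 22)

theorem Runs.mapLabels {W n k : ℕ} {B : Prog} {φ : ℕ → ℕ} {s : State} (hnW : n < W)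
    (h0 : s.reg 0 = n) (h2 : s.reg 2 = 1)
    (hB : ∀ s' : State, (∀ x < 20, s'.reg x = s.reg x) → Runs W k B s' fun s'' =>
      (∀ x < 22, s''.reg x = s'.reg x) ∧ (∀ a i, s''.arr a i = s'.arr a i) ∧
        s''.reg 22 = φ (s'.reg 22)) :
    Runs W (n * (k + 4) + 2) (mapLabels B) s fun s' => (∀ x < 20, s'.reg x = s.reg x) ∧
      (∀ a ≠ 0, ∀ i, s'.arr a i = s.arr a i) ∧ ∀ i < n, s'.arr 0 i = φ (s.arr 0 i) := by
  refine (Runs.forLoop (N := n) (k := k + 2) (I := fun j s' =>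
    (∀ x < 20, s'.reg x = s.reg x) ∧ (∀ a ≠ 0, ∀ i, s'.arr a i = s.arr a i) ∧ s'.reg 21 = j ∧
      (∀ i < j, s'.arr 0 i = φ (s.arr 0 i)) ∧ ∀ i ≥ j, s'.arr 0 i = s.arr 0 i) hnW
    (by grind) (by grind) ?_).mono (by ring_nf; rfl) (by grind)
  intro j _ s' _
  exact .load_seq (.call_seq (hB _ (by grind)) fun s'' _ => .store (by grind))

/-- Exchanges the weights of the blocks in registers `10` and `11`. -/
def swapWeights : Prog :=
  .load 20 2 10 ;; .load 21 2 11 ;; .store 2 10 21 ;; .store 2 11 20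

theorem Runs.swapWeights {W : ℕ} {s : State} :
    Runs W 4 swapWeights s fun s' => (∀ x < 20, s'.reg x = s.reg x) ∧
      (∀ a ≠ 2, ∀ i, s'.arr a i = s.arr a i) ∧
      ∀ j, s'.arr 2 j = s.arr 2 (Equiv.swap (s.reg 10) (s.reg 11) j) :=
  .load_seq (.load_seq (.store_seq (.store (by grind))))

/-- Exchanges the labels in registers `10` and `11`. -/
def swapLabels : Prog :=
  mapLabels (ifEq 22 10 (copy 22 11) (ifEq 22 11 (copy 22 10) .skip))

theorem Runs.swapLabels {W n : ℕ} {s : State} (hnW : n < W) (h0 : s.reg 0 = n)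
    (h2 : s.reg 2 = 1) (h3 : s.reg 3 = 0) :
    Runs W (n * 9 + 2) swapLabels s fun s' => (∀ x < 20, s'.reg x = s.reg x) ∧
      (∀ a ≠ 0, ∀ i, s'.arr a i = s.arr a i) ∧
      ∀ i < n, s'.arr 0 i = Equiv.swap (s.reg 10) (s.reg 11) (s.arr 0 i) :=
  .mapLabels (k := 5) hnW h0 h2 fun s' _ =>
    .ifEq (fun _ => (Runs.copy (by grind) (by grind)).mono (by omega) fun _ => id) fun _ =>
      .ifEq (fun _ => .copy (by grind) (by grind)) fun _ => .skip (by grind)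

/-- Exchanges a block of least weight with the last one. -/
def moveMinLast : Prog :=
  argmin ;; copy 10 20 ;; .op .sub 11 8 2 ;; swapWeights ;; swapLabels

theorem Runs.moveMinLast {W n q : ℕ} {s : State} (hnW : n < W) (hqn : q < n) (h0 : s.reg 0 = n)
    (h2 : s.reg 2 = 1) (h3 : s.reg 3 = 0) (h8 : s.reg 8 = q + 1) :
    Runs W (n * 15 + 11) moveMinLast s fun s' => (∀ x < 9, s'.reg x = s.reg x) ∧ ∃ A ≤ q,
      (∀ j ≤ q, s.arr 2 A ≤ s.arr 2 j) ∧ (∀ i < n, s'.arr 0 i = Equiv.swap A q (s.arr 0 i)) ∧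
      ∀ j, s'.arr 2 j = s.arr 2 (Equiv.swap A q j) := by
  refine (Runs.call_seq (.argmin (r := q + 1) (by omega) (by omega) h2 h3 h8) fun s₁ _ =>
    .copy_seq (by grind) <| .op_seq (by grind [Op.eval, State.Bounded]) <|
    .call_seq .swapWeights fun s₂ _ =>
    (Runs.swapLabels (n := n) hnW ?_ ?_ ?_).mono le_rfl fun s₃ _ => ⟨?_, s₁.reg 20, ?_⟩).mono
      (by omega) fun _ => id
  all_goals grind [Op.eval]

/-- Replaces the label in register `8` by that in register `10`. -/
def mergeLabels : Prog :=
  mapLabels (ifEq 22 8 (copy 22 10) .skip)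

theorem Runs.mergeLabels {W n : ℕ} {s : State} (hnW : n < W) (h0 : s.reg 0 = n)
    (h2 : s.reg 2 = 1) (h3 : s.reg 3 = 0) :
    Runs W (n * 7 + 2) mergeLabels s fun s' => (∀ x < 20, s'.reg x = s.reg x) ∧
      (∀ a ≠ 0, ∀ i, s'.arr a i = s.arr a i) ∧
      ∀ i < n, s'.arr 0 i = Function.update id (s.reg 8) (s.reg 10) (s.arr 0 i) :=
  .mapLabels (k := 3) hnW h0 h2 fun s' _ =>
    .ifEq (fun _ => .copy (by grind) (by grind)) fun _ => .skip (by grind)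

/-- Joins the last block with a lightest one of the others. -/
def mergeLast : Prog :=
  .op .sub 8 8 2 ;; argmin ;; copy 10 20 ;; .load 20 2 10 ;; .load 21 2 8 ;; .op .add 20 20 21 ;;
  .store 2 10 20 ;; mergeLabels

theorem Runs.mergeLast {W n q : ℕ} {s : State} (hq : 0 < q) (hqn : q < n) (hnW : n < W)
    (h0 : s.reg 0 = n) (h2 : s.reg 2 = 1) (h3 : s.reg 3 = 0) (h8 : s.reg 8 = q + 1)
    (hadd : ∀ j < q, s.arr 2 j + s.arr 2 q < W) :
    Runs W (n * 13 + 11) mergeLast s fun s' => (∀ x < 8, s'.reg x = s.reg x) ∧ s'.reg 8 = q ∧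
      ∃ B < q, (∀ j < q, s.arr 2 B ≤ s.arr 2 j) ∧
        (∀ i < n, s'.arr 0 i = Function.update id q B (s.arr 0 i)) ∧
        ∀ j < q, s'.arr 2 j = if j = B then s.arr 2 q + s.arr 2 B else s.arr 2 j := by
  refine (Runs.op_seq (by grind [Op.eval, State.Bounded]) <|
    .call_seq (.argmin (r := q) hq (by omega) (by grind) (by grind) (by grind [Op.eval]))
      fun s₁ _ => .copy_seq (by grind) <| .load_seq <| .load_seq <|
    .op_seq (by grind [Op.eval]) <| .store_seq <|
    (Runs.mergeLabels (n := n) hnW ?_ ?_ ?_).mono le_rfl fun s₃ _ => ⟨?_, ?_, s₁.reg 20, ?_⟩).mono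
      (by omega) fun _ => id
  all_goals grind [Op.eval]


/-- Puts into register `21` the power of register `20` whose exponent is in register `7`. -/
def power : Prog :=
  .const 21 1 ;; forLoop 22 7 (.op .mul 21 21 20)

theorem Runs.power {W k a : ℕ} {s : State} (h2 : s.reg 2 = 1) (h7 : s.reg 7 = k)
    (h20 : s.reg 20 = a) (hkW : k < W) (h1W : 1 < W) (hW : a ^ k < W) :
    Runs W (k * 3 + 3) power s fun s' => (∀ x ≤ 20, s'.reg x = s.reg x) ∧
      (∀ a i, s'.arr a i = s.arr a i) ∧ s'.reg 21 = a ^ k := by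
  have hpow : ∀ j ≤ k, a ^ j < W := by
    intro j hj
    obtain rfl | ha := a.eq_zero_or_pos
    · exact (pow_le_one₀ le_rfl zero_le_one).trans_lt h1W
    · exact (Nat.pow_le_pow_right ha hj).trans_lt hW
  refine .const_seq h1W ((Runs.forLoop (N := k) (k := 1) (I := fun j s' =>
    (∀ x ≤ 20, s'.reg x = s.reg x) ∧ (∀ a i, s'.arr a i = s.arr a i) ∧ s'.reg 21 = a ^ j ∧
      s'.reg 22 = j) hkW (by grind) (by grind) ?_).mono le_rfl (by grind))
  intro j hj s' _
  have := hpow (j + 1) hj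
  exact .op (by grind [Op.eval]) (by grind [Op.eval])

/-- Puts into register `22` the number of binary digits of register `21`. -/
def binarySize : Prog :=
  .const 22 0 ;; .while 3 21 (.op .div 21 21 5 ;; .op .add 22 22 2)

theorem Runs.binarySize {W b : ℕ} {s : State} (h2 : s.reg 2 = 1) (h3 : s.reg 3 = 0)
    (h5 : s.reg 5 = 2) (h21 : s.reg 21 = b) (hbW : b < W) :
    Runs W (b.size * 3 + 2) binarySize s fun s' => (∀ x ≤ 20, s'.reg x = s.reg x) ∧
      (∀ a i, s'.arr a i = s.arr a i) ∧ s'.reg 22 = b.size := by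
  refine .const_seq (by omega) ((Runs.while (N := b.size) (k := 2) (I := fun j s' =>
    (∀ x ≤ 20, s'.reg x = s.reg x) ∧ (∀ a i, s'.arr a i = s.arr a i) ∧ s'.reg 21 = b / 2 ^ j ∧
      s'.reg 22 = j) (by grind) ?_ ?_).mono le_rfl (by grind))
  · have : b / 2 ^ b.size = 0 := Nat.div_eq_of_lt (Nat.lt_size_self b)
    grind
  · intro j hj s' _
    have : 0 < b / 2 ^ j := Nat.div_pos (Nat.lt_size.1 hj) (by positivity)
    have : b / 2 ^ j / 2 = b / 2 ^ (j + 1) := by rw [Nat.div_div_eq_div_mul, pow_succ]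
    have : b.size ≤ b := Nat.size_le.2 Nat.lt_two_pow_self
    exact ⟨by grind, .op_seq (by grind [Op.eval, State.Bounded, Nat.div_le_self]) <|
      .op (by grind [Op.eval]) (by grind [Op.eval])⟩

/-- Puts into register `22` the number of binary digits of the power of register `20` whose
exponent is in register `7`. -/
def sizePow : Prog := power ;; binarySize

theorem Runs.sizePow {W k a : ℕ} {s : State} (h2 : s.reg 2 = 1) (h3 : s.reg 3 = 0)
    (h5 : s.reg 5 = 2) (h7 : s.reg 7 = k) (h20 : s.reg 20 = a) (hkW : k < W) (h1W : 1 < W)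
    (hW : a ^ k < W) :
    Runs W (k * 3 + (a ^ k).size * 3 + 5) sizePow s fun s' => (∀ x ≤ 20, s'.reg x = s.reg x) ∧
      (∀ a i, s'.arr a i = s.arr a i) ∧ s'.reg 22 = (a ^ k).size :=
  (Runs.call_seq (.power h2 h7 h20 hkW h1W hW) fun s' _ =>
    (Runs.binarySize (b := a ^ k) (by grind) (by grind) (by grind) (by grind) hW).mono le_rfl
      (by grind)).mono (by omega) fun _ => id

/-- Puts into register `6` the sum of the products `(w ^ k).size * w`, where `w` ranges over the
weights in array `2` and `k` is in register `7`. -/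
def sumSizePow : Prog :=
  .const 6 0 ;; forLoop 9 1 (.load 20 2 9 ;; sizePow ;; .op .mul 22 22 20 ;; .op .add 6 6 22)

theorem Runs.sumSizePow {W m k D : ℕ} {s : State} (h1 : s.reg 1 = m) (h2 : s.reg 2 = 1)
    (h3 : s.reg 3 = 0) (h5 : s.reg 5 = 2) (h7 : s.reg 7 = k) (hsum : ∑ j : Fin m, s.arr 2 j = D)
    (hmW : m < W) (hkW : k < W) (h1W : 1 < W) (hpow : D ^ k < W) (hmul : (D ^ k).size * D < W) :
    Runs W (m * (k * 3 + (D ^ k).size * 3 + 10) + 3) sumSizePow s fun s' =>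
      (∀ x < 6, s'.reg x = s.reg x) ∧ s'.reg 7 = k ∧ (∀ a i, s'.arr a i = s.arr a i) ∧
      s'.reg 6 = ∑ j : Fin m, (s.arr 2 j ^ k).size * s.arr 2 j := by
  have hle : ∀ j < m, s.arr 2 j ≤ D := fun j hj => hsum ▸
    Finset.single_le_sum (f := fun j : Fin m => s.arr 2 j) (fun _ _ => Nat.zero_le _)
      (Finset.mem_univ ⟨j, hj⟩)
  have hpart : ∀ j < m, ∑ i ∈ Finset.range (j + 1), (s.arr 2 i ^ k).size * s.arr 2 i < W :=
    fun j hj => (Finset.sum_le_sum_of_subset (Finset.range_subset_range.2 hj)).trans_lt <| by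
      rw [Finset.sum_range]
      exact (sum_size_pow_mul_le k hsum).trans_lt hmul
  rw [← Finset.sum_range fun j => (s.arr 2 j ^ k).size * s.arr 2 j]
  refine .const_seq (by omega) ((Runs.forLoop (N := m) (k := k * 3 + (D ^ k).size * 3 + 8)
    (I := fun j s' => (∀ x < 6, s'.reg x = s.reg x) ∧ s'.reg 7 = k ∧
      (∀ a i, s'.arr a i = s.arr a i) ∧ s'.reg 9 = j ∧
      s'.reg 6 = ∑ i ∈ Finset.range j, (s.arr 2 i ^ k).size * s.arr 2 i) hmW
    (by grind [Finset.sum_range_zero]) (by grind) ?_).mono le_rfl (by grind))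
  intro j hj s' _
  have hpow_le := Nat.pow_le_pow_left (hle j hj) k
  have hsize_le := Nat.size_le_size hpow_le
  have hpart := Finset.sum_range_succ (fun i => (s.arr 2 i ^ k).size * s.arr 2 i) j ▸ hpart j hj
  refine (Runs.load_seq (.call_seq (.sizePow (k := k) (a := s.arr 2 j) ?_ ?_ ?_ ?_ ?_ hkW h1W ?_)
    fun s'' _ => .op_seq ?_ (.op ?_ ?_))).mono ?_ fun _ => id
  all_goals grind [Op.eval, Finset.sum_range_succ]

/-- Puts into register `0` the numerator of the approximation of the entropy of the weights in
array `2` with the common denominator in register `4`, and into register `1` its denominator. -/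
def approxEntropy (k : ℕ) : Prog :=
  .const 7 k ;; sumSizePow ;; copy 20 4 ;; sizePow ;;
  .op .add 22 22 2 ;; .op .mul 22 22 4 ;; .op .sub 0 22 6 ;; .op .mul 1 4 7

theorem Runs.approxEntropy {W m k D : ℕ} {s : State} (h1 : s.reg 1 = m) (h2 : s.reg 2 = 1)
    (h3 : s.reg 3 = 0) (h4 : s.reg 4 = D) (h5 : s.reg 5 = 2) (hsum : ∑ j : Fin m, s.arr 2 j = D)
    (hD : 0 < D) (hk : 0 < k) (hmW : m < W) (hW : 2 * k * D ^ (k + 1) < W) :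
    Runs W ((m + 1) * (k * 3 + (D ^ k).size * 3 + 14)) (approxEntropy k) s fun s' =>
      (∀ a i, s'.arr a i = s.arr a i) ∧
      s'.reg 0 = entropyNumerator k D (fun j : Fin m => s.arr 2 j) ∧ s'.reg 1 = D * k := by
  have hDk : 1 ≤ D ^ k := Nat.one_le_pow _ _ hD
  have hDk' : D ≤ D ^ (k + 1) := Nat.le_self_pow k.succ_ne_zero D
  have hsize : (D ^ k).size ≤ D ^ k := Nat.size_le.2 Nat.lt_two_pow_self
  have hmul : ((D ^ k).size + 1) * D < W := hW.trans_le' <| calc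
    ((D ^ k).size + 1) * D ≤ (2 * D ^ k) * D := by gcongr; omega
    _ ≤ 2 * k * D ^ (k + 1) := by rw [mul_assoc, ← pow_succ]; gcongr; omega
  have hDkW : D * k < W := by nlinarith
  have hkW : 2 * k < W := by nlinarith
  have hpow : D ^ k < W := (Nat.pow_le_pow_right hD (Nat.le_add_right k 1)).trans_lt (by nlinarith)
  have hsizeD : (D ^ k).size * D < W := by linarith
  have hsizeW : (D ^ k).size + 1 < W := by nlinarith
  refine (Runs.const_seq (by omega) (.call_seq (.sumSizePow (k := k) (D := D) (m := m)
    ?_ ?_ ?_ ?_ ?_ ?_ hmW ?_ ?_ ?_ ?_) fun s' _ => .copy_seq ?_ <|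
    .call_seq (.sizePow (k := k) (a := D) ?_ ?_ ?_ ?_ ?_ ?_ ?_ ?_) fun s'' _ =>
    .op_seq ?_ <| .op_seq ?_ <| .op_seq ?_ <| .op ?_ ?_)).mono ?_ fun _ => id
  all_goals first | omega | grind [Op.eval, entropyNumerator]


section ShowsPartition

variable {W n m q : ℕ} {a F : Fin n → ℕ} {s : State}

/-- The state `s` shows the partition of `Fin n` into the blocks `F = j` with `j < r`, where `i` has
weight `a i`, on the way to `m` blocks. Registers `0` and `1` hold `n` and `m`, registers `2`, `3`
and `5` the constants `1`, `0` and `2`, register `4` the total weight and register `8` the number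
`r` of blocks; array `0` holds the labels `F` and array `2` the weights of the blocks. -/
structure ShowsPartition (m : ℕ) (a F : Fin n → ℕ) (r : ℕ) (s : State) : Prop where
  reg_zero : s.reg 0 = n
  reg_one : s.reg 1 = m
  reg_two : s.reg 2 = 1
  reg_three : s.reg 3 = 0
  reg_four : s.reg 4 = ∑ i, a i
  reg_five : s.reg 5 = 2
  reg_eight : s.reg 8 = r
  isLabelling : IsLabelling F r
  labels : ∀ i : Fin n, s.arr 0 i = F i
  weights : ∀ j < r, s.arr 2 j = ∑ i ∈ labelBlock F j, a i

theorem ShowsPartition.runs_moveMinLast (h : ShowsPartition m a F (q + 1) s) (hqn : q < n)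
    (hnW : n < W) :
    Runs W (n * 15 + 11) moveMinLast s fun s' => ∃ G : Fin n → ℕ,
      labelBlocks G (q + 1) = labelBlocks F (q + 1) ∧ ShowsPartition m a G (q + 1) s' ∧
      ∀ j ≤ q, s'.arr 2 q ≤ s'.arr 2 j := by
  obtain ⟨h0, h1, h2, h3, h4, h5, h8, hF, hlabels, hweights⟩ := h
  refine (Runs.moveMinLast hnW hqn h0 h2 h3 h8).mono le_rfl ?_
  rintro s' ⟨hreg, A, hA, hmin, hlabels', hweights'⟩
  have hA' : A < q + 1 := Nat.lt_succ_of_le hA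
  have hswap : ∀ j ≤ q, Equiv.swap A q j ≤ q := by grind
  refine ⟨Equiv.swap A q ∘ F, labelBlocks_swap_comp hA' q.lt_succ_self F, ⟨by grind, by grind,
    by grind, by grind, by grind, by grind, by grind, hF.swap_comp hA' q.lt_succ_self,
    by grind, fun j hj => ?_⟩, by grind⟩
  rw [labelBlock_swap_comp, hweights', hweights _ (by grind)]

theorem ShowsPartition.weight_add_weight_le (h : ShowsPartition m a F (q + 1) s) {j : ℕ}
    (hj : j < q) : s.arr 2 j + s.arr 2 q ≤ ∑ i, a i := by
  rw [h.weights j (by omega), h.weights q q.lt_succ_self,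
    ← Finset.sum_union (disjoint_labelBlock F hj.ne)]
  exact Finset.sum_le_sum_of_subset (Finset.subset_univ _)

theorem ShowsPartition.runs_mergeLast (h : ShowsPartition m a F (q + 1) s) (hq : 0 < q)
    (hqn : q < n) (hnW : n < W) (haW : ∑ i, a i < W) (hlast : ∀ j ≤ q, s.arr 2 q ≤ s.arr 2 j) :
    Runs W (n * 13 + 11) mergeLast s fun s' => ∃ G : Fin n → ℕ,
      HuffmanStep (fun i => (a i : ℝ)) (labelBlocks F (q + 1)) (labelBlocks G q) ∧
      ShowsPartition m a G q s' := by
  have hadd : ∀ j < q, s.arr 2 j + s.arr 2 q < W := fun j hj =>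
    (h.weight_add_weight_le hj).trans_lt haW
  obtain ⟨h0, h1, h2, h3, h4, h5, h8, hF, hlabels, hweights⟩ := h
  have hle : ∀ i ≤ q, ∀ j ≤ q, s.arr 2 i ≤ s.arr 2 j →
      ∑ i ∈ labelBlock F i, (a i : ℝ) ≤ ∑ i ∈ labelBlock F j, (a i : ℝ) := fun i hi j hj hij => by
    rw [hweights i (by omega), hweights j (by omega)] at hij
    exact_mod_cast hij
  refine (Runs.mergeLast hq hqn hnW h0 h2 h3 h8 hadd).mono le_rfl ?_
  rintro s' ⟨hreg, h8', B, hB, hmin, hlabels', hweights'⟩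
  refine ⟨Function.update id q B ∘ F, hF.huffmanStep_merge hB
    (fun j hj => hle q le_rfl j hj.le (hlast j hj.le))
    (fun j hj => hle B hB.le j hj.le (hmin j hj)), ⟨by grind, by grind, by grind, by grind,
    by grind, by grind, h8', hF.merge hB, by grind, fun j hj => ?_⟩⟩
  rw [labelBlock_merge hj, hweights' j hj, apply_ite (fun C => ∑ i ∈ C, a i),
    Finset.sum_union (disjoint_labelBlock F hB.ne'), hweights q q.lt_succ_self,
    hweights B (by omega), hweights j (by omega)]

/-- Joins two blocks of least weight until their number is that in register `1`. -/
def mergeLoop : Prog := .while 1 8 (moveMinLast ;; mergeLast)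

theorem ShowsPartition.runs_mergeLoop (h : ShowsPartition m a Fin.val n s) (hm : 0 < m)
    (hmn : m ≤ n) (hnW : n < W) (haW : ∑ i, a i < W) :
    Runs W (n * (n * 28 + 23) + 1) mergeLoop s fun s' => ∃ F : Fin n → ℕ,
      HuffmanRun (fun i => (a i : ℝ)) (n - m) (labelBlocks F m) ∧ ShowsPartition m a F m s' := by
  refine (Runs.while (N := n - m) (k := n * 28 + 22) (I := fun k s' => ∃ F : Fin n → ℕ,
    HuffmanRun (fun i => (a i : ℝ)) k (labelBlocks F (n - k)) ∧ ShowsPartition m a F (n - k) s')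
    ⟨Fin.val, by rw [Nat.sub_zero, labelBlocks_val]; exact .zero, h⟩ ?_ ?_).mono ?_ ?_
  · rintro s' ⟨F, -, hF⟩
    rw [hF.reg_one, hF.reg_eight]
    omega
  · rintro k hk s' ⟨F, hrun, hF⟩
    obtain ⟨q, hq⟩ := Nat.exists_eq_add_one_of_ne_zero (Nat.sub_pos_of_lt (by omega : k < n)).ne'
    rw [hq] at hrun hF
    rw [show n - (k + 1) = q by omega, hF.reg_one, hF.reg_eight]
    refine ⟨by omega, (Runs.call_seq (hF.runs_moveMinLast (by omega) hnW) ?_).mono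
      (by omega : n * 15 + 11 + (n * 13 + 11) ≤ _) fun _ => id⟩
    rintro s₁ ⟨G, hG, hshows, hlast⟩
    refine (hshows.runs_mergeLast (by omega) (by omega) hnW haW hlast).mono le_rfl ?_
    rintro s₂ ⟨G', hstep, hG'⟩
    exact ⟨G', hrun.succ (hG ▸ hstep), hG'⟩
  · gcongr
    omega
  · rw [Nat.sub_sub_self hmn]
    exact fun _ => id

end ShowsPartition


section CommonDenominator

variable {n : ℕ} {p : Fin n → ℚ}

/-- A common denominator of the probabilities. It need not be the least one: the product of the
denominators is simpler to compute and no longer than the input. -/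
def commonDen (p : Fin n → ℚ) : ℕ := ∏ i, (p i).den

/-- The numerator of `p i` over the common denominator. -/
def commonNum (p : Fin n → ℚ) (i : Fin n) : ℕ :=
  (p i).num.natAbs * commonDen p / (p i).den

theorem commonDen_pos (p : Fin n → ℚ) : 0 < commonDen p :=
  Finset.prod_pos fun i _ => (p i).den_pos

theorem den_dvd_commonDen (p : Fin n → ℚ) (i : Fin n) : (p i).den ∣ commonDen p :=
  Finset.dvd_prod_of_mem _ (Finset.mem_univ i)

theorem den_le_commonDen (p : Fin n → ℚ) (i : Fin n) : (p i).den ≤ commonDen p :=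
  Nat.le_of_dvd (commonDen_pos p) (den_dvd_commonDen p i)

theorem commonNum_div_commonDen (hp : ∀ i, 0 ≤ p i) (i : Fin n) :
    (commonNum p i : ℚ) / commonDen p = p i := by
  have hden : ((p i).den : ℚ) ≠ 0 := Nat.cast_ne_zero.2 (p i).den_ne_zero
  have hD : (commonDen p : ℚ) ≠ 0 := Nat.cast_ne_zero.2 (commonDen_pos p).ne'
  have hnum : (((p i).num.natAbs : ℕ) : ℚ) = (p i).num := by
    rw [Nat.cast_natAbs, abs_of_nonneg (Rat.num_nonneg.2 (hp i))]
  rw [commonNum, Nat.mul_div_assoc _ (den_dvd_commonDen p i), Nat.cast_mul,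
    Nat.cast_div (den_dvd_commonDen p i) hden, hnum, mul_div_assoc, div_div_cancel_left' hD,
    ← div_eq_mul_inv, Rat.num_div_den]

theorem sum_commonNum (hp : p ∈ stdSimplex ℚ (Fin n)) : ∑ i, commonNum p i = commonDen p := by
  have h : ((∑ i, commonNum p i : ℕ) : ℚ) / commonDen p = 1 := by
    rw [Nat.cast_sum, Finset.sum_div,
      Finset.sum_congr rfl fun i _ => commonNum_div_commonDen hp.1 i, hp.2]
  exact_mod_cast eq_of_div_eq_one h

theorem natAbs_num_le_den (hp : p ∈ stdSimplex ℚ (Fin n)) (i : Fin n) :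
    (p i).num.natAbs ≤ (p i).den := by
  have hnum := Rat.num_nonneg.2 (hp.1 i)
  have hle := Rat.num_le_denom_iff.2 (mem_Icc_of_mem_stdSimplex hp i).2
  omega

theorem le_inputSize (m : ℕ) (p : Fin n → ℚ) : n ≤ inputSize m p := calc
  n = ∑ _i : Fin n, 1 := by simp
  _ ≤ ∑ i, ((p i).num.natAbs.size + (p i).den.size) := Finset.sum_le_sum fun i _ =>
    (Nat.size_pos.2 (p i).den_pos).trans_le (Nat.le_add_left _ _)
  _ ≤ inputSize m p := Nat.le_add_left _ _

theorem commonDen_lt_two_pow_inputSize {m : ℕ} (hm : 0 < m) (p : Fin n → ℚ) :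
    commonDen p < 2 ^ inputSize m p := calc
  commonDen p ≤ ∏ i, 2 ^ (p i).den.size :=
    Finset.prod_le_prod' fun i _ => (Nat.lt_size_self _).le
  _ = 2 ^ ∑ i, (p i).den.size := Finset.prod_pow_eq_pow_sum ..
  _ < 2 ^ inputSize m p := Nat.pow_lt_pow_right one_lt_two <| by
    have := Nat.size_pos.2 hm
    rw [inputSize, Finset.sum_add_distrib]
    omega

end CommonDenominator

/-- Puts the product of the first entries of array `1` into register `4`. -/
def commonDenominator : Prog :=
  .const 4 1 ;; forLoop 9 0 (.load 20 1 9 ;; .op .mul 4 4 20)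

theorem Runs.commonDenominator {W n D : ℕ} {s : State} (h0 : s.reg 0 = n) (h2 : s.reg 2 = 1)
    (hnW : n < W) (h1W : 1 < W) (hpos : ∀ i < n, 0 < s.arr 1 i)
    (hD : ∏ i ∈ Finset.range n, s.arr 1 i = D) (hDW : D < W) :
    Runs W (n * 4 + 3) commonDenominator s fun s' => (∀ x < 9, x ≠ 4 → s'.reg x = s.reg x) ∧
      s'.reg 4 = D ∧ ∀ a i, s'.arr a i = s.arr a i := by
  have hpart : ∀ j < n, ∏ i ∈ Finset.range (j + 1), s.arr 1 i < W := fun j hj =>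
    (Finset.prod_le_prod_of_subset_of_one_le' (Finset.range_subset_range.2 hj)
      fun i hi _ => hpos i (Finset.mem_range.1 hi)).trans_lt (hD ▸ hDW)
  refine .const_seq h1W ((Runs.forLoop (N := n) (k := 2) (I := fun j s' =>
    (∀ x < 9, x ≠ 4 → s'.reg x = s.reg x) ∧ s'.reg 4 = ∏ i ∈ Finset.range j, s.arr 1 i ∧
      s'.reg 9 = j ∧ ∀ a i, s'.arr a i = s.arr a i) hnW (by grind [Finset.prod_range_zero])
    (by grind) ?_).mono le_rfl (by grind))
  intro j hj s' _
  have := hpart j hj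
  exact .load_seq (.op (by grind [Op.eval, Finset.prod_range_succ])
    (by grind [Op.eval, Finset.prod_range_succ]))

/-- Puts the numerators over the common denominator in register `4` of the fractions in arrays `0`
and `1` into array `2`, and makes the labels in array `0` distinct. -/
def commonNumerators : Prog :=
  forLoop 9 0 (.load 20 0 9 ;; .load 21 1 9 ;; .op .mul 20 20 4 ;; .op .div 20 20 21 ;;
    .store 2 9 20 ;; .store 0 9 9)

theorem Runs.commonNumerators {W n D : ℕ} {s : State} (h0 : s.reg 0 = n) (h2 : s.reg 2 = 1)
    (h4 : s.reg 4 = D) (hnW : n < W) (hmul : ∀ i < n, s.arr 0 i * D < W) :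
    Runs W (n * 8 + 2) commonNumerators s fun s' => (∀ x < 9, s'.reg x = s.reg x) ∧
      ∀ i < n, s'.arr 0 i = i ∧ s'.arr 2 i = s.arr 0 i * D / s.arr 1 i := by
  refine (Runs.forLoop (N := n) (k := 6) (I := fun j s' => (∀ x < 9, s'.reg x = s.reg x) ∧
    s'.reg 9 = j ∧ (∀ i, s'.arr 1 i = s.arr 1 i) ∧ (∀ i ≥ j, s'.arr 0 i = s.arr 0 i) ∧
      ∀ i < j, s'.arr 0 i = i ∧ s'.arr 2 i = s.arr 0 i * D / s.arr 1 i) hnW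
    (by grind) (by grind) ?_).mono le_rfl (by grind)
  intro j hj s' _
  have := hmul j hj
  exact .load_seq <| .load_seq <| .op_seq (by grind [Op.eval]) <|
    .op_seq (fun hs => (Nat.div_le_self ..).trans_lt (hs.1 _)) <|
    .store_seq <| .store (by grind [Op.eval])

/-- Turns the input into the partition into singletons. -/
def setup : Prog :=
  .const 2 1 ;; .const 5 2 ;; commonDenominator ;; commonNumerators ;; copy 8 0

theorem Runs.setup {W n m : ℕ} {p : Fin n → ℚ} (hp : p ∈ stdSimplex ℚ (Fin n)) (h2W : 2 < W)
    (hnW : n < W) (hDW : commonDen p * commonDen p < W) :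
    Runs W (n * 12 + 8) setup (inputState m p) (ShowsPartition m (commonNum p) Fin.val n) := by
  have hnum (i : Fin n) : (inputState m p).arr 0 i = (p i).num.natAbs := by simp [inputState]
  have hden (i : Fin n) : (inputState m p).arr 1 i = (p i).den := by simp [inputState]
  have h0 : (inputState m p).reg 0 = n := rfl
  have h1 : (inputState m p).reg 1 = m := rfl
  have h3 : (inputState m p).reg 3 = 0 := rfl
  have hprod : ∏ i ∈ Finset.range n, (inputState m p).arr 1 i = commonDen p := by
    rw [Finset.prod_range, commonDen, Finset.prod_congr rfl fun i _ => hden i]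
  have hpos : ∀ i < n, 0 < (inputState m p).arr 1 i := fun i hi =>
    (hden ⟨i, hi⟩).symm ▸ (p ⟨i, hi⟩).den_pos
  have hmul : ∀ i < n, (inputState m p).arr 0 i * commonDen p < W := fun i hi =>
    (Nat.mul_le_mul_right _ <| (hnum ⟨i, hi⟩).trans_le <|
      (natAbs_num_le_den hp ⟨i, hi⟩).trans (den_le_commonDen p ⟨i, hi⟩)).trans_lt hDW
  have hDW' : commonDen p < W := (Nat.le_mul_self _).trans_lt hDW
  have hweight : ∀ j < n, (inputState m p).arr 0 j * commonDen p / (inputState m p).arr 1 j =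
      ∑ i ∈ labelBlock (Fin.val : Fin n → ℕ) j, commonNum p i := fun j hj => by
    rw [labelBlock_val ⟨j, hj⟩, Finset.sum_singleton, commonNum, ← hnum, ← hden]
  refine (Runs.const_seq (by omega) <| .const_seq h2W <| .call_seq
    (.commonDenominator (n := n) (D := commonDen p) ?_ ?_ hnW (by omega) ?_ ?_ hDW')
    fun s₁ hs₁ => .call_seq
    (.commonNumerators (n := n) (D := commonDen p) ?_ ?_ ?_ hnW ?_) fun s₂ hs₂ =>
    .copy ?_ ⟨?_, ?_, ?_, ?_, (sum_commonNum hp).symm ▸ ?_, ?_, ?_, isLabelling_val n,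
      fun i => ?_, fun j hj => hweight j hj ▸ ?_⟩).mono (by omega) fun _ => id
  all_goals grind


section Huffman

variable {W n m k : ℕ}

theorem ShowsPartition.sum_weights {a F : Fin n → ℕ} {s : State} (h : ShowsPartition m a F m s) :
    ∑ j : Fin m, s.arr 2 j = ∑ i, a i := by
  rw [← Finset.sum_fiberwise (g := h.isLabelling.toFin)]
  refine Finset.sum_congr rfl fun j _ => (h.weights j j.2).trans ?_
  simp only [labelBlock, IsLabelling.toFin, Fin.ext_iff]

theorem ShowsPartition.distOfFun_div {a F : Fin n → ℕ} {s : State} (h : ShowsPartition m a F m s)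
    (c : ℝ) : distOfFun (fun i => a i / c) h.isLabelling.toFin =
      fun j : Fin m => (s.arr 2 j : ℝ) / c := by
  funext j
  rw [h.weights j j.2, Nat.cast_sum, Finset.sum_div, distOfFun]
  simp only [labelBlock, IsLabelling.toFin, Fin.ext_iff]

/-- Huffman merging, followed by an approximate computation of the entropy. -/
def huffman (k : ℕ) : Prog := setup ;; mergeLoop ;; approxEntropy k

/-- The output `(f, v)` consists of a function obtained by Huffman steps and an approximation of its
entropy. -/
def HuffmanOutput (m k : ℕ) (p : Fin n → ℚ) (s : State) : Prop :=
  ∃ (f : Fin n → Fin m) (v : ℚ), IsOutput s f v ∧ IsHuffmanFun (fun i => (p i : ℝ)) f ∧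
    (v : ℝ) ∈ Set.Icc (shannonEntropy (distOfFun (fun i => (p i : ℝ)) f))
      (shannonEntropy (distOfFun (fun i => (p i : ℝ)) f) + 2 / k)

theorem Runs.huffman {p : Fin n → ℚ} (hp : p ∈ stdSimplex ℚ (Fin n)) (hm : 0 < m) (hmn : m ≤ n)
    (hk : 0 < k) (hnW : n < W) (hW : 2 * k * commonDen p ^ (k + 1) < W) :
    Runs W (n * 12 + 8 + (n * (n * 28 + 23) + 1 +
        (m + 1) * (k * 3 + (commonDen p ^ k).size * 3 + 14))) (huffman k) (inputState m p)
      (HuffmanOutput m k p) := by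
  have hD := commonDen_pos p
  have hsum := sum_commonNum hp
  have hDD : 2 * (commonDen p * commonDen p) < W := hW.trans_le' <| by
    rw [← sq]
    gcongr <;> omega
  have hDD' := Nat.le_mul_self (commonDen p)
  have hcast : (fun i => (p i : ℝ)) = fun i => (commonNum p i : ℝ) / commonDen p :=
    funext fun i => by
      simpa using congrArg (Rat.cast (K := ℝ)) (commonNum_div_commonDen hp.1 i).symm
  refine .call_seq (.setup hp (by omega) hnW (by omega)) fun s₁ h₁ =>
    .call_seq (h₁.runs_mergeLoop hm hmn hnW (by omega)) ?_
  rintro s₂ ⟨F, hrun, h₂⟩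
  refine (Runs.approxEntropy h₂.reg_one h₂.reg_two h₂.reg_three (hsum ▸ h₂.reg_four) h₂.reg_five
    (hsum ▸ h₂.sum_weights) hD hk (by omega) hW).mono le_rfl ?_
  rintro s₃ ⟨harr, h0, h1⟩
  have happrox := entropyNumerator_div_mem_Icc hk hD (hsum ▸ h₂.sum_weights)
  refine ⟨h₂.isLabelling.toFin, s₃.reg 0 / s₃.reg 1, ⟨fun i => ?_, ?_, rfl⟩, ?_, ?_⟩
  · rw [harr, h₂.labels]
    rfl
  · rw [h1]
    positivity
  · rw [hcast]
    exact h₂.isLabelling.isHuffmanFun_toFin (hrun.div_const (Nat.cast_nonneg _))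
  · rw [hcast, h₂.distOfFun_div, h0, h1]
    rw [Rat.cast_div, Rat.cast_natCast, Rat.cast_natCast]
    exact happrox

theorem inputState_bounded {p : Fin n → ℚ} (hp : p ∈ stdSimplex ℚ (Fin n)) (hnW : n < W)
    (hmW : m < W) (hDW : commonDen p < W) : (inputState m p).Bounded W := by
  refine ⟨fun x => ?_, fun a i => ?_⟩
  · simp only [inputState]
    split_ifs <;> omega
  · simp only [inputState]
    split_ifs with hi
    · exact ((natAbs_num_le_den hp _).trans (den_le_commonDen p _)).trans_lt hDW
    · exact (den_le_commonDen p _).trans_lt hDW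
    all_goals omega

/-- A bound for the cost of `huffman k` in terms of the size of the input. -/
noncomputable def huffmanCost (k : ℕ) : Polynomial ℕ :=
  (.X * 12 + 8 + (.X * (.X * 28 + 23) + 1 + (.X + 1) * (k * 3 + .X * k * 3 + 14))) *
    (1 + 3 * (.X * (k + 1) + 2 * k + 1))

theorem exists_exec_huffman {p : Fin n → ℚ} (hp : p ∈ stdSimplex ℚ (Fin n)) (hm : 0 < m)
    (hmn : m ≤ n) (hk : 0 < k) :
    ∃ t s, Exec (huffman k) (inputState m p) t s ∧
      t ≤ (huffmanCost k).eval (inputSize m p) ∧ HuffmanOutput m k p s := by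
  have hnS := le_inputSize m p
  have hDS := commonDen_lt_two_pow_inputSize hm p
  set S := inputSize m p
  have hSW : 2 ^ S ≤ 2 ^ (S * (k + 1) + 2 * k) := Nat.pow_le_pow_right two_pos (by nlinarith)
  have hnW : n < 2 ^ (S * (k + 1) + 2 * k) := (hnS.trans_lt Nat.lt_two_pow_self).trans_le hSW
  have hDW : commonDen p < 2 ^ (S * (k + 1) + 2 * k) := hDS.trans_le hSW
  have hW : 2 * k * commonDen p ^ (k + 1) < 2 ^ (S * (k + 1) + 2 * k) := by
    rw [pow_add 2, pow_mul, mul_comm]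
    exact Nat.mul_lt_mul'' (Nat.pow_lt_pow_left hDS k.succ_ne_zero) Nat.lt_two_pow_self
  have hsize : (commonDen p ^ k).size ≤ S * k := Nat.size_le.2 <|
    pow_mul 2 S k ▸ Nat.pow_lt_pow_left hDS hk.ne'
  have hmS : m ≤ S := hmn.trans hnS
  obtain ⟨t, s, hexec, ht, -, hout⟩ :=
    Runs.huffman hp hm hmn hk hnW hW (inputState_bounded hp hnW (hmn.trans_lt hnW) hDW)
  refine ⟨t, s, hexec, ht.trans ?_, hout⟩
  simp only [huffmanCost, Nat.size_pow, Polynomial.eval_mul, Polynomial.eval_add,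
    Polynomial.eval_X, Polynomial.eval_ofNat, Polynomial.eval_one, Polynomial.eval_natCast,
    Nat.cast_id]
  gcongr

end Huffman

end RAM

/-- First: `α < 0.0861`. Second, for every real distribution, `n - m` Huffman steps can be carried
out, and however the ties are broken, the entropy they lead to is within `α` of the maximum. Third,
one program does this for all rational distributions in polynomial time: it outputs a function `f`
obtained by `n - m` Huffman steps, with `H(f(X))` within `α` of the maximum, and a rational number
`v` within `α` of the maximum. -/
theorem corollary1 :
    alphaConst < 0.0861 ∧
    (∀ (n m : ℕ) (p : Fin n → ℝ), 2 ≤ m → m < n → p ∈ stdSimplex ℝ (Fin n) →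
      (∃ f : Fin n → Fin m, IsHuffmanFun p f) ∧
      ∃ M : ℝ, IsGreatest (entropyValues m p) M ∧
        ∀ f : Fin n → Fin m, IsHuffmanFun p f →
          M - alphaConst ≤ shannonEntropy (distOfFun p f) ∧
          shannonEntropy (distOfFun p f) ≤ M) ∧
    ∃ (P : RAM.Prog) (T : Polynomial ℕ),
      ∀ (n m : ℕ) (p : Fin n → ℚ), 2 ≤ m → m < n → p ∈ stdSimplex ℚ (Fin n) →
        ∃ (t : ℕ) (s : RAM.State) (f : Fin n → Fin m) (v : ℚ) (M : ℝ),
          RAM.Exec P (RAM.inputState m p) t s ∧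
          t ≤ T.eval (RAM.inputSize m p) ∧
          RAM.IsOutput s f v ∧
          IsHuffmanFun (fun i => (p i : ℝ)) f ∧
          IsGreatest (entropyValues m fun i => (p i : ℝ)) M ∧
          M - alphaConst ≤ shannonEntropy (distOfFun (fun i => (p i : ℝ)) f) ∧
          shannonEntropy (distOfFun (fun i => (p i : ℝ)) f) ≤ M ∧
          |(v : ℝ) - M| ≤ alphaConst := by
  refine ⟨alphaConst_lt, fun n m p hm hmn hp => ?_, RAM.huffman 32, RAM.huffmanCost 32,
    fun n m p hm hmn hp => ?_⟩
  · obtain ⟨f, hf⟩ := exists_isHuffmanFun (by omega : 0 < m) hmn.le p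
    obtain ⟨M, hM⟩ := exists_isGreatest_entropyValues p hf.1
    exact ⟨⟨f, hf⟩, M, hM, fun g hg => hg.entropy_bounds hp hM⟩
  · obtain ⟨t, s, hexec, ht, f, v, hout, hf, hv_ge, hv_le⟩ :=
      RAM.exists_exec_huffman (k := 32) hp (by omega : 0 < m) hmn.le (by norm_num)
    have hp' : (fun i => (p i : ℝ)) ∈ stdSimplex ℝ (Fin n) :=
      ⟨fun i => Rat.cast_nonneg.2 (hp.1 i), by simpa using congrArg (Rat.cast (K := ℝ)) hp.2⟩
    obtain ⟨M, hM⟩ := exists_isGreatest_entropyValues (fun i => (p i : ℝ)) hf.1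
    obtain ⟨hge, hle⟩ := hf.entropy_bounds hp' hM
    have hα := one_div_sixteen_le_alphaConst
    exact ⟨t, s, f, v, M, hexec, ht, hout, hf, hM, hge, hle, abs_le.2 ⟨by linarith, by linarith⟩⟩
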